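/- All objects are of class $C^\infty$. Let $(M,g)$ be a pseudo-Riemannian manifold of finite dimension $n$ with Levi-Civita connection $\nabla$, and let $c$ be a symmetric $(0,2)$-tensor field on $M$. Let $T^2M$ be the second-order tangent bundle of $M$, that is, the $3n$-dimensional manifold of $2$-jets at $0$ of curves $F$ in $M$, with the induced coordinates $$x^i=F^i(0),\qquad y^i=\frac{dF^i}{dt}(0),\qquad z^i=\frac12\frac{d^2F^i}{dt^2}(0).$$ Write $\partial_i=\partial/\partial x^i$, $\partial_{\bar i}=\partial/\partial y^i$, $\partial_{\bar{\bar i}}=\partial/\partial z^i$. The $0$-th, $1$-st and $2$-nd lifts to $T^2M$ of a vector field $X=X^j\partial_j$ on $M$ are $${}^{0}X=X^j\partial_{\bar{\bar j}},\qquad {}^{I}X=X^j\partial_{\bar j}+y^s\partial_sX^j\,\partial_{\bar{\bar j}},$$ $${}^{II}X=X^j\partial_j+y^s\partial_sX^j\,\partial_{\bar j}+\Big(z^s\partial_sX^j+\tfrac12y^ty^s\partial_t\partial_sX^j\Big)\partial_{\bar{\bar j}}.$$ The deformed $2$-nd lift metric $\bar g={}^{II}g+{}^{0}c$ on $T^2M$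 is the pseudo-Riemannian metric with the matrix $$\bar g=\begin{pmatrix} z^s\partial_sg_{ij}+\frac12y^ty^s\partial_t\partial_sg_{ij}+c_{ij} & y^s\partial_sg_{ij} & g_{ij}\\ y^s\partial_sg_{ij} & g_{ij} & 0\\ g_{ij} & 0 & 0\end{pmatrix}$$ in induced coordinates, and $\bar\nabla$ is its Levi-Civita connection. Let $H$ be the $(1,2)$-tensor field on $M$ defined by $$g(H(Y,Z),W)=\tfrac12\big[(\nabla_Yc)(Z,W)+(\nabla_Zc)(Y,W)-(\nabla_Wc)(Y,Z)\big].$$ A vector field $V$ on a pseudo-Riemannian manifold with Levi-Civita connection $D$ is called affine Killing if $L_VD=0$, where $(L_VD)(Y,Z)=[V,D_YZ]-D_{[V,Y]}Z-D_Y[V,Z]$. **Proposition.** Let $X$ be a vector field on $M$. (i) ${}^{0}X$ is affine Killing on $(T^2M,\bar g)$ if and only if $X$ is affine Killing on $(M,g)$; likewise, ${}^{I}X$ is affine Killing on $(T^2M,\bar g)$ if and only if $X$ is affine Killing on $(M,g)$. In particular, ${}^0X$ and ${}^IX$ are both affine Killing if and only if $X$ is. (ii) ${}^{II}X$ is affine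 Killing on $(T^2M,\bar g)$ if and only if $X$ is affine Killing on $(M,g)$ and $L_XH=0$. -/

import Mathlib

open scoped Manifold ContDiff Topology

noncomputable section
namespace SecondTangent

section Jets

variable {E : Type*} [NormedAddCommGroup E] [NormedSpace ℝ E]

/-- The map `(x, y, z) ↦ (f x, Df(x) y, Df(x) z + ½ D²f(x)(y, y))` that `f` induces on 2-jets
of curves. -/
def prolong {F : Type*} [NormedAddCommGroup F] [NormedSpace ℝ F] (f : E → F) (u : E × E × E) :
    F × F × F :=
  (f u.1, fderiv ℝ f u.1 u.2.1,
    fderiv ℝ f u.1 u.2.2 + (1 / 2 : ℝ) • fderiv ℝ (fderiv ℝ f) u.1 u.2.1 u.2.1)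

/-- The numbers `(γ(0), γ'(0), ½ γ''(0))` that describe the 2-jet at `0` of a curve. -/
def curveJet (γ : ℝ → E) : E × E × E :=
  (γ 0, deriv γ 0, (1 / 2 : ℝ) • deriv (deriv γ) 0)

theorem curveJet_congr {γ δ : ℝ → E} (h : γ =ᶠ[𝓝 0] δ) : curveJet γ = curveJet δ := by
  simp only [curveJet, h.eq_of_nhds, h.deriv_eq, h.deriv.deriv_eq]

theorem curveJet_comp {F : Type*} [NormedAddCommGroup F] [NormedSpace ℝ F] {f : E → F} {γ : ℝ → E}
    (hf : ContDiffAt ℝ ∞ f (γ 0)) (hγ : ContDiffAt ℝ ∞ γ 0) :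
    curveJet (f ∘ γ) = prolong f (curveJet γ) := by
  have h2 : deriv (f ∘ γ) =ᶠ[𝓝 0] fun t ↦ fderiv ℝ f (γ t) (deriv γ t) := by
    have h3 : ∀ᶠ t in 𝓝 (0 : ℝ), ContDiffAt ℝ 1 f (γ t) :=
      hγ.continuousAt.eventually
        ((hf.of_le (m := 1) (by exact_mod_cast le_top)).eventually (by decide))
    have h4 : ∀ᶠ t in 𝓝 (0 : ℝ), ContDiffAt ℝ 1 γ t :=
      (hγ.of_le (m := 1) (by exact_mod_cast le_top)).eventually (by decide)
    filter_upwards [h3, h4] with t h3 h4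
    exact fderiv_comp_deriv t (h3.differentiableAt (by simp)) (h4.differentiableAt (by simp))
  have hfd : DifferentiableAt ℝ (fderiv ℝ f) (γ 0) :=
    (hf.fderiv_right (m := ∞) (by simp)).differentiableAt (by simp)
  have hγd : DifferentiableAt ℝ (deriv γ) 0 := by
    have := (hγ.fderiv_right (m := ∞) (by simp)).differentiableAt (by simp)
    exact this.clm_apply (differentiableAt_const 1)
  have hγ1 : DifferentiableAt ℝ γ 0 := hγ.differentiableAt (by simp)
  have h5 : HasDerivAt (fun t ↦ fderiv ℝ f (γ t) (deriv γ t))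
      (fderiv ℝ (fderiv ℝ f) (γ 0) (deriv γ 0) (deriv γ 0)
        + fderiv ℝ f (γ 0) (deriv (deriv γ) 0)) 0 :=
    (hfd.hasFDerivAt.comp_hasDerivAt 0 hγ1.hasDerivAt).clm_apply hγd.hasDerivAt
  simp only [curveJet, prolong, Function.comp_apply]
  refine Prod.ext rfl (Prod.ext ?_ ?_)
  · exact h2.eq_of_nhds
  · simp only
    rw [h2.deriv_eq, h5.deriv, smul_add, map_smul]
    abel

/-- The curve `t ↦ x + t y + t² z`, whose 2-jet is `(x, y, z)`. -/
def jetCurve (u : E × E × E) (t : ℝ) : E := u.1 + t • u.2.1 + t ^ 2 • u.2.2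

theorem contDiff_jetCurve (u : E × E × E) : ContDiff ℝ ∞ (jetCurve u) := by
  unfold jetCurve; fun_prop

theorem curveJet_jetCurve (u : E × E × E) : curveJet (jetCurve u) = u := by
  have h : deriv (jetCurve u) = fun t : ℝ ↦ u.2.1 + (2 * t) • u.2.2 := by
    funext t
    have : HasDerivAt (jetCurve u) _ t := ((hasDerivAt_const t u.1).add ((hasDerivAt_id t).smul_const u.2.1)).add
      ((hasDerivAt_pow 2 t).smul_const u.2.2)
    simpa using this.deriv
  have h' : deriv (deriv (jetCurve u)) 0 = (2 : ℝ) • u.2.2 := by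
    rw [h]
    have : HasDerivAt (fun t : ℝ ↦ u.2.1 + (2 * t) • u.2.2) _ 0 := (hasDerivAt_const (0 : ℝ) u.2.1).add
      (((hasDerivAt_id (0 : ℝ)).const_mul 2).smul_const u.2.2)
    simpa using this.deriv
  refine Prod.ext ?_ (Prod.ext ?_ ?_)
  · simp [curveJet, jetCurve]
  · simp [curveJet, h]
  · simp [curveJet, h', smul_smul]

theorem contDiffOn_prolong {f : E → E} {s : Set E} (hs : IsOpen s) (hf : ContDiffOn ℝ ∞ f s) :
    ContDiffOn ℝ ∞ (prolong f) (Prod.fst ⁻¹' s) := by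
  have h1 : ContDiffOn ℝ ∞ (fun u : E × E × E ↦ f u.1) (Prod.fst ⁻¹' s) :=
    hf.comp contDiffOn_fst (fun _ h ↦ h)
  have d1 : ContDiffOn ℝ ∞ (fderiv ℝ f) s := hf.fderiv_of_isOpen hs (by simp)
  have d2 : ContDiffOn ℝ ∞ (fderiv ℝ (fderiv ℝ f)) s := d1.fderiv_of_isOpen hs (by simp)
  have d1' : ContDiffOn ℝ ∞ (fun u : E × E × E ↦ fderiv ℝ f u.1) (Prod.fst ⁻¹' s) :=
    d1.comp contDiffOn_fst (fun _ h ↦ h)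
  have d2' : ContDiffOn ℝ ∞ (fun u : E × E × E ↦ fderiv ℝ (fderiv ℝ f) u.1) (Prod.fst ⁻¹' s) :=
    d2.comp contDiffOn_fst (fun _ h ↦ h)
  unfold prolong
  refine h1.prodMk (ContDiffOn.prodMk ?_ ?_)
  · exact d1'.clm_apply (by fun_prop)
  · exact (d1'.clm_apply (by fun_prop)).add
      (contDiffOn_const.smul ((d2'.clm_apply (by fun_prop)).clm_apply (by fun_prop)))

theorem curveJet_chart_jetCurve {M : Type*} [TopologicalSpace M] {e : OpenPartialHomeomorph M E}
    {u : E × E × E} (hu : u.1 ∈ e.target) : curveJet (e ∘ (e.symm ∘ jetCurve u)) = u := by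
  have h0 : jetCurve u 0 = u.1 := by simp [jetCurve]
  refine (curveJet_congr ?_).trans (curveJet_jetCurve u)
  have : ∀ᶠ t in 𝓝 (0 : ℝ), jetCurve u t ∈ e.target :=
    (contDiff_jetCurve u).continuous.continuousAt.preimage_mem_nhds
      (e.open_target.mem_nhds (h0.symm ▸ hu))
  filter_upwards [this] with t ht
  simp [e.right_inv ht]

end Jets

section Bundle

variable (E : Type*) [NormedAddCommGroup E] [NormedSpace ℝ E]
  (M : Type*) [TopologicalSpace M] [ChartedSpace E M]

/-- Curves in `M` that are smooth near the parameter value `0`. -/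
def SmoothCurve : Type _ := {γ : ℝ → M // ContMDiffAt 𝓘(ℝ, ℝ) 𝓘(ℝ, E) ∞ γ 0}

/-- Two curves have the same 2-jet if they have the same value at `0` and if, in each chart around
it, their first and second derivatives at `0` agree. -/
def jetSetoid : Setoid (SmoothCurve E M) where
  r γ δ := γ.1 0 = δ.1 0 ∧ ∀ e ∈ atlas E M, γ.1 0 ∈ e.source →
    curveJet (e ∘ γ.1) = curveJet (e ∘ δ.1)
  iseqv := by
    refine ⟨fun _ ↦ ⟨rfl, fun _ _ _ ↦ rfl⟩, ?_, ?_⟩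
    · rintro γ δ ⟨h, h'⟩
      exact ⟨h.symm, fun e he hs ↦ (h' e he (h ▸ hs)).symm⟩
    · rintro γ δ ε ⟨h, h'⟩ ⟨k, k'⟩
      exact ⟨h.trans k, fun e he hs ↦ (h' e he hs).trans (k' e he (h ▸ hs))⟩

/-- The second-order tangent bundle `T²M`: the set of 2-jets of curves in `M`. -/
def SecondTangentBundle : Type _ := Quotient (jetSetoid E M)

variable {E M}

/-- The 2-jet at `0` of a curve. -/
def jet (γ : ℝ → M) (hγ : ContMDiffAt 𝓘(ℝ, ℝ) 𝓘(ℝ, E) ∞ γ 0) : SecondTangentBundle E M :=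
  Quotient.mk (jetSetoid E M) ⟨γ, hγ⟩

/-- The projection `T²M → M`. -/
def proj (p : SecondTangentBundle E M) : M :=
  Quotient.lift (fun γ : SmoothCurve E M ↦ γ.1 0)
    (fun γ δ (h : (jetSetoid E M).r γ δ) ↦ h.1) p

/-- The coordinates `(x, y, z)` induced on `T²M` by a chart `e` of `M`: the 2-jet of `γ` has
the coordinates `((e ∘ γ)(0), (e ∘ γ)'(0), ½ (e ∘ γ)''(0))`, see `inducedCoord_jet`. -/
def inducedCoord (e : OpenPartialHomeomorph M E) (p : SecondTangentBundle E M) : E × E × E :=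
  curveJet (e ∘ p.out.1)

theorem inducedCoord_jet {e : OpenPartialHomeomorph M E} (he : e ∈ atlas E M) {γ : ℝ → M}
    (hγ : ContMDiffAt 𝓘(ℝ, ℝ) 𝓘(ℝ, E) ∞ γ 0) (h0 : γ 0 ∈ e.source) :
    inducedCoord e (jet γ hγ) = curveJet (e ∘ γ) := by
  have h : (jetSetoid E M).r (jet γ hγ).out ⟨γ, hγ⟩ := Quotient.exact (Quotient.out_eq (jet γ hγ))
  exact h.2 e he (h.1 ▸ h0)

variable [IsManifold 𝓘(ℝ, E) ∞ M]

theorem mem_max {e : OpenPartialHomeomorph M E} (he : e ∈ atlas E M) :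
    e ∈ IsManifold.maximalAtlas 𝓘(ℝ, E) ∞ M := IsManifold.subset_maximalAtlas he

theorem contDiffOn_transition {e e' : OpenPartialHomeomorph M E} (he : e ∈ atlas E M)
    (he' : e' ∈ atlas E M) : ContDiffOn ℝ ∞ (e.symm.trans e') (e.symm.trans e').source := by
  have h : e.symm.trans e' ∈ contDiffGroupoid ∞ 𝓘(ℝ, E) :=
    HasGroupoid.compatible he he'
  exact (contMDiffOn_of_mem_contDiffGroupoid h).contDiffOn

theorem contDiffAt_chart_comp {e : OpenPartialHomeomorph M E} (he : e ∈ atlas E M) {γ : ℝ → M}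
    (hγ : ContMDiffAt 𝓘(ℝ, ℝ) 𝓘(ℝ, E) ∞ γ 0) (h0 : γ 0 ∈ e.source) :
    ContDiffAt ℝ ∞ (e ∘ γ) 0 :=
  ((contMDiffAt_of_mem_maximalAtlas (mem_max he) h0).comp 0 hγ).contDiffAt

theorem curveJet_change {e e' : OpenPartialHomeomorph M E} (he : e ∈ atlas E M)
    (he' : e' ∈ atlas E M) {γ : ℝ → M} (hγ : ContMDiffAt 𝓘(ℝ, ℝ) 𝓘(ℝ, E) ∞ γ 0)
    (h0 : γ 0 ∈ e.source) (h0' : γ 0 ∈ e'.source) :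
    curveJet (e' ∘ γ) = prolong (e.symm.trans e') (curveJet (e ∘ γ)) := by
  have hmem : (e ∘ γ) 0 ∈ (e.symm.trans e').source := by simp [h0, h0']
  rw [← curveJet_comp ((contDiffOn_transition he he').contDiffAt
    ((e.symm.trans e').open_source.mem_nhds hmem)) (contDiffAt_chart_comp he hγ h0)]
  apply curveJet_congr
  filter_upwards [hγ.continuousAt.preimage_mem_nhds (e.open_source.mem_nhds h0)] with t ht
  simp [e.left_inv (Set.mem_preimage.1 ht)]

theorem contMDiffAt_chartCurve {e : OpenPartialHomeomorph M E} (he : e ∈ atlas E M)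
    {u : E × E × E} (hu : u.1 ∈ e.target) :
    ContMDiffAt 𝓘(ℝ, ℝ) 𝓘(ℝ, E) ∞ (e.symm ∘ jetCurve u) 0 := by
  have h0 : jetCurve u 0 = u.1 := by simp [jetCurve]
  exact (contMDiffAt_symm_of_mem_maximalAtlas (mem_max he) (h0.symm ▸ hu)).comp 0
    (contDiff_jetCurve u).contDiffAt.contMDiffAt

open Classical in
/-- The 2-jet with given induced coordinates. -/
def jetOfCoord (e : OpenPartialHomeomorph M E) (he : e ∈ atlas E M) (u : E × E × E) :
    SecondTangentBundle E M :=
  if hu : u.1 ∈ e.target then jet (e.symm ∘ jetCurve u) (contMDiffAt_chartCurve he hu)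
  else jet (fun _ ↦ e.symm u.1) contMDiffAt_const

theorem jetOfCoord_of_mem {e : OpenPartialHomeomorph M E} (he : e ∈ atlas E M) {u : E × E × E}
    (hu : u.1 ∈ e.target) :
    jetOfCoord e he u = jet (e.symm ∘ jetCurve u) (contMDiffAt_chartCurve he hu) := dif_pos hu

theorem proj_jetOfCoord {e : OpenPartialHomeomorph M E} (he : e ∈ atlas E M) {u : E × E × E}
    (hu : u.1 ∈ e.target) : proj (jetOfCoord e he u) = e.symm u.1 := by
  rw [jetOfCoord_of_mem he hu]
  change e.symm (jetCurve u 0) = _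
  simp [jetCurve]

theorem jetOfCoord_curveJet {e : OpenPartialHomeomorph M E} (he : e ∈ atlas E M) {γ : ℝ → M}
    (hγ : ContMDiffAt 𝓘(ℝ, ℝ) 𝓘(ℝ, E) ∞ γ 0) (h : γ 0 ∈ e.source) :
    jetOfCoord e he (curveJet (e ∘ γ)) = jet γ hγ := by
  have hu : (curveJet (e ∘ γ)).1 ∈ e.target := e.map_source h
  have hb : (e.symm ∘ jetCurve (curveJet (e ∘ γ))) 0 = γ 0 := by
    simp [jetCurve, curveJet, e.left_inv h]
  rw [jetOfCoord_of_mem he hu]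
  refine Quotient.sound (s := jetSetoid E M) ⟨hb, fun e' he' hs ↦ ?_⟩
  have hs' : γ 0 ∈ e'.source := hb ▸ hs
  change curveJet (e' ∘ (e.symm ∘ jetCurve (curveJet (e ∘ γ)))) = curveJet (e' ∘ γ)
  rw [curveJet_change he he' (contMDiffAt_chartCurve he hu) (hb ▸ h) hs,
    curveJet_change he he' hγ h hs', curveJet_chart_jetCurve hu]

/-- The induced coordinates as a bijection from `π⁻¹(U)` onto `e(U) × E × E`. -/
def inducedPartialEquiv (e : OpenPartialHomeomorph M E) (he : e ∈ atlas E M) :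
    PartialEquiv (SecondTangentBundle E M) (E × E × E) where
  toFun := inducedCoord e
  invFun := jetOfCoord e he
  source := proj ⁻¹' e.source
  target := Prod.fst ⁻¹' e.target
  map_source' := by
    rintro ⟨γ, hγ⟩ (h : γ 0 ∈ e.source)
    change (inducedCoord e (jet γ hγ)).1 ∈ e.target
    rw [inducedCoord_jet he hγ h]
    exact e.map_source h
  map_target' := by
    intro u (hu : u.1 ∈ e.target)
    change proj _ ∈ e.source
    rw [proj_jetOfCoord he hu]
    exact e.map_target hu
  left_inv' := by
    rintro ⟨γ, hγ⟩ (h : γ 0 ∈ e.source)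
    change jetOfCoord e he (inducedCoord e (jet γ hγ)) = jet γ hγ
    rw [inducedCoord_jet he hγ h, jetOfCoord_curveJet he hγ h]
  right_inv' := by
    intro u (hu : u.1 ∈ e.target)
    have h0 : (e.symm ∘ jetCurve u) 0 = e.symm u.1 := by simp [jetCurve]
    rw [jetOfCoord_of_mem he hu, inducedCoord_jet he _ (h0 ▸ e.map_target hu)]
    exact curveJet_chart_jetCurve hu

theorem inducedCoord_symm {e : OpenPartialHomeomorph M E} (he : e ∈ atlas E M)
    {e' : OpenPartialHomeomorph M E} (he' : e' ∈ atlas E M) {u : E × E × E}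
    (hu : u.1 ∈ (e.symm.trans e').source) :
    (inducedPartialEquiv e' he') ((inducedPartialEquiv e he).symm u) =
      prolong (e.symm.trans e') u := by
  have hu1 : u.1 ∈ e.target := by simpa using hu.1
  have hb : (e.symm ∘ jetCurve u) 0 = e.symm u.1 := by simp [jetCurve]
  change inducedCoord e' (jetOfCoord e he u) = _
  rw [jetOfCoord_of_mem he hu1, inducedCoord_jet he' _ (hb ▸ hu.2),
    curveJet_change he he' (contMDiffAt_chartCurve he hu1) (hb ▸ e.map_target hu1) (hb ▸ hu.2),
    curveJet_chart_jetCurve hu1]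

theorem inducedPartialEquiv_trans_source {e e' : OpenPartialHomeomorph M E} (he : e ∈ atlas E M)
    (he' : e' ∈ atlas E M) :
    ((inducedPartialEquiv e he).symm.trans (inducedPartialEquiv e' he')).source =
      Prod.fst ⁻¹' (e.symm.trans e').source := by
  ext u
  constructor
  · rintro ⟨h1 : u.1 ∈ e.target, h2 : proj (jetOfCoord e he u) ∈ e'.source⟩
    exact ⟨h1, by simpa [proj_jetOfCoord he h1] using h2⟩
  · rintro ⟨h1 : u.1 ∈ e.target, h2 : e.symm u.1 ∈ e'.source⟩
    refine ⟨h1, ?_⟩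
    change proj (jetOfCoord e he u) ∈ e'.source
    rwa [proj_jetOfCoord he h1]

theorem contDiffOn_induced_transition {e e' : OpenPartialHomeomorph M E} (he : e ∈ atlas E M)
    (he' : e' ∈ atlas E M) :
    ContDiffOn ℝ ∞ ((inducedPartialEquiv e he).symm.trans (inducedPartialEquiv e' he'))
      ((inducedPartialEquiv e he).symm.trans (inducedPartialEquiv e' he')).source := by
  rw [inducedPartialEquiv_trans_source]
  exact (contDiffOn_prolong (e.symm.trans e').open_source (contDiffOn_transition he he')).congr
    fun u hu ↦ inducedCoord_symm he he' hu

variable (E M) in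
/-- The induced coordinate systems, as an atlas that generates the topology of `T²M`. -/
def chartedSpaceCore : ChartedSpaceCore (E × E × E) (SecondTangentBundle E M) where
  atlas := {f | ∃ e, ∃ he : e ∈ atlas E M, f = inducedPartialEquiv e he}
  chartAt p := inducedPartialEquiv (chartAt E (proj p)) (chart_mem_atlas E (proj p))
  mem_chart_source p := mem_chart_source E (proj p)
  chart_mem_atlas p := ⟨_, chart_mem_atlas E (proj p), rfl⟩
  open_source := by
    rintro _ _ ⟨e, he, rfl⟩ ⟨e', he', rfl⟩
    rw [inducedPartialEquiv_trans_source]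
    exact (e.symm.trans e').open_source.preimage continuous_fst
  continuousOn_toFun := by
    rintro _ _ ⟨e, he, rfl⟩ ⟨e', he', rfl⟩
    exact (contDiffOn_induced_transition he he').continuousOn

instance : TopologicalSpace (SecondTangentBundle E M) := (chartedSpaceCore E M).toTopologicalSpace

instance : ChartedSpace (E × E × E) (SecondTangentBundle E M) :=
  (chartedSpaceCore E M).toChartedSpace

/-- The chart of `T²M` induced by a chart of `M`. -/
def inducedChart (e : OpenPartialHomeomorph M E) (he : e ∈ atlas E M) :
    OpenPartialHomeomorph (SecondTangentBundle E M) (E × E × E) :=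
  (chartedSpaceCore E M).openPartialHomeomorph (inducedPartialEquiv e he) ⟨e, he, rfl⟩

theorem mem_atlas_iff {f : OpenPartialHomeomorph (SecondTangentBundle E M) (E × E × E)} :
    f ∈ atlas (E × E × E) (SecondTangentBundle E M) ↔
      ∃ e, ∃ he : e ∈ atlas E M, f = inducedChart e he := by
  constructor
  · intro h
    obtain ⟨_, ⟨f', rfl⟩, h⟩ := h
    obtain ⟨_, ⟨⟨e, he, rfl⟩, rfl⟩, rfl⟩ := h
    exact ⟨e, he, rfl⟩
  · rintro ⟨e, he, rfl⟩
    exact Set.mem_iUnion₂.2 ⟨inducedPartialEquiv e he, ⟨e, he, rfl⟩, rfl⟩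

instance : IsManifold 𝓘(ℝ, E × E × E) ∞ (SecondTangentBundle E M) := by
  refine isManifold_of_contDiffOn _ _ _ fun f f' hf hf' ↦ ?_
  obtain ⟨e, he, rfl⟩ := mem_atlas_iff.1 hf
  obtain ⟨e', he', rfl⟩ := mem_atlas_iff.1 hf'
  have := contDiffOn_induced_transition he he'
  simpa using! this

end Bundle

section Geometry

variable {F : Type*} [NormedAddCommGroup F] [NormedSpace ℝ F]
  {N : Type*} [TopologicalSpace N] [ChartedSpace F N]

/-- The components of a vector field in a chart. -/
def vecInChart (e : OpenPartialHomeomorph N F) (X : Π p : N, TangentSpace 𝓘(ℝ, F) p) (u : F) : F :=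
  mfderiv 𝓘(ℝ, F) 𝓘(ℝ, F) e (e.symm u) (X (e.symm u))

/-- The components of a `(0,2)`-tensor field in a chart. -/
def formInChart (e : OpenPartialHomeomorph N F)
    (g : Π p : N, TangentSpace 𝓘(ℝ, F) p →L[ℝ] TangentSpace 𝓘(ℝ, F) p →L[ℝ] ℝ) (u : F) :
    F →L[ℝ] F →L[ℝ] ℝ :=
  let A : F →L[ℝ] F := mfderiv 𝓘(ℝ, F) 𝓘(ℝ, F) e.symm u
  let B : F →L[ℝ] F →L[ℝ] ℝ := g (e.symm u)
  B.bilinearComp A A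

/-- The vector `a` with `B(a, b) = φ(b)` for all `b`; it exists and is unique when `B` is a
nondegenerate form on a finite-dimensional space and `φ` is linear. -/
def sharp (B : F →L[ℝ] F →L[ℝ] ℝ) (φ : F → ℝ) : F :=
  Classical.epsilon fun a ↦ ∀ b, B a b = φ b

/-- The Christoffel symbols `Γ(v, w)` of the Levi-Civita connection of a metric `G`, in
coordinates: `2 G(Γ(v, w), b) = ∂_v G(w, b) + ∂_w G(v, b) - ∂_b G(v, w)`. -/
def christoffel (G : F → F →L[ℝ] F →L[ℝ] ℝ) (u v w : F) : F :=
  sharp (G u) fun b ↦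
    (1 / 2 : ℝ) * (fderiv ℝ G u v w b + fderiv ℝ G u w v b - fderiv ℝ G u b v w)

/-- The Lie derivative along `V` of a `(1,2)`-tensor field `S`, in coordinates. -/
def lieDerivTensor (V : F → F) (S : F → F → F → F) (u v w : F) : F :=
  fderiv ℝ (fun u' ↦ S u' v w) u (V u) - fderiv ℝ V u (S u v w)
    + S u (fderiv ℝ V u v) w + S u v (fderiv ℝ V u w)

/-- The Lie derivative along `V` of the Levi-Civita connection of `G`, in coordinates: this is
`[V, ∇_Y Z] - ∇_{[V, Y]} Z - ∇_Y [V, Z]` for fields with `Y(u) = v`, `Z(u) = w`. -/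
def lieDerivConnection (G : F → F →L[ℝ] F →L[ℝ] ℝ) (V : F → F) (u v w : F) : F :=
  fderiv ℝ (fderiv ℝ V) u v w + lieDerivTensor V (christoffel G) u v w

/-- `X` is an affine Killing vector field of `(N, g)`: the Lie derivative along `X` of the
Levi-Civita connection of `g` vanishes. -/
def IsAffineKilling
    (g : Π p : N, TangentSpace 𝓘(ℝ, F) p →L[ℝ] TangentSpace 𝓘(ℝ, F) p →L[ℝ] ℝ)
    (X : Π p : N, TangentSpace 𝓘(ℝ, F) p) : Prop :=
  ∀ e ∈ atlas F N, ∀ u ∈ e.target, ∀ v w : F,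
    lieDerivConnection (formInChart e g) (vecInChart e X) u v w = 0

/-- The covariant derivative `(∇_v C)(w, b)` of a `(0,2)`-tensor field `C` with respect to the
Levi-Civita connection of `G`, in coordinates. -/
def covDerivForm (G C : F → F →L[ℝ] F →L[ℝ] ℝ) (u v w b : F) : ℝ :=
  fderiv ℝ C u v w b - C u (christoffel G u v w) b - C u w (christoffel G u v b)

/-- The `(1,2)`-tensor field `H` with
`2 G(H(v, w), b) = (∇_v C)(w, b) + (∇_w C)(v, b) - (∇_b C)(v, w)`, in coordinates. -/
def deformationTensor (G C : F → F →L[ℝ] F →L[ℝ] ℝ) (u v w : F) : F :=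
  sharp (G u) fun b ↦ (1 / 2 : ℝ) *
    (covDerivForm G C u v w b + covDerivForm G C u w v b - covDerivForm G C u b v w)

/-- `L_X H = 0`, where `H` is the `(1,2)`-tensor field that belongs to `g` and `c`. -/
def LieDerivDeformationVanishes
    (g c : Π p : N, TangentSpace 𝓘(ℝ, F) p →L[ℝ] TangentSpace 𝓘(ℝ, F) p →L[ℝ] ℝ)
    (X : Π p : N, TangentSpace 𝓘(ℝ, F) p) : Prop :=
  ∀ e ∈ atlas F N, ∀ u ∈ e.target, ∀ v w : F,
    lieDerivTensor (vecInChart e X)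
      (deformationTensor (formInChart e g) (formInChart e c)) u v w = 0

end Geometry

section Tensors

variable (E : Type*) [NormedAddCommGroup E] [NormedSpace ℝ E]
  (M : Type*) [TopologicalSpace M] [ChartedSpace E M] [IsManifold 𝓘(ℝ, E) ∞ M]

/-- A smooth symmetric `(0,2)`-tensor field. -/
structure SymmetricTensor where
  val (p : M) : TangentSpace 𝓘(ℝ, E) p →L[ℝ] TangentSpace 𝓘(ℝ, E) p →L[ℝ] ℝ
  symm (p : M) (v w : TangentSpace 𝓘(ℝ, E) p) : val p v w = val p w v
  contMDiff : ContMDiff 𝓘(ℝ, E) (𝓘(ℝ, E).prod 𝓘(ℝ, E →L[ℝ] E →L[ℝ] ℝ)) ∞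
    (fun p ↦ Bundle.TotalSpace.mk' (E →L[ℝ] E →L[ℝ] ℝ)
      (E := fun p : M ↦ TangentSpace 𝓘(ℝ, E) p →L[ℝ] TangentSpace 𝓘(ℝ, E) p →L[ℝ] ℝ) p (val p))

/-- A pseudo-Riemannian metric: a smooth symmetric nondegenerate `(0,2)`-tensor field. -/
structure PseudoRiemannianMetric extends SymmetricTensor E M where
  nondegenerate (p : M) (v : TangentSpace 𝓘(ℝ, E) p) : (∀ w, val p v w = 0) → v = 0

end Tensors

section Lifts

variable {E : Type*} [NormedAddCommGroup E] [NormedSpace ℝ E]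

/-- Components `X^j ∂_z̄` of the 0-th lift. -/
def lift0Comp (V : E → E) (u : E × E × E) : E × E × E := (0, 0, V u.1)

/-- Components of the 1-st lift at `(x, y, z)`: `(0, V(x), DV(x) y)`. -/
def lift1Comp (V : E → E) (u : E × E × E) : E × E × E := (0, V u.1, fderiv ℝ V u.1 u.2.1)

/-- Components of the 2-nd lift at `(x, y, z)`:
`(V(x), DV(x) y, DV(x) z + ½ D²V(x)(y, y))`. -/
def lift2Comp (V : E → E) (u : E × E × E) : E × E × E :=
  (V u.1, fderiv ℝ V u.1 u.2.1,
    fderiv ℝ V u.1 u.2.2 + (1 / 2 : ℝ) • fderiv ℝ (fderiv ℝ V) u.1 u.2.1 u.2.1)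

/-- Components of the 0-th lift of a `(0,2)`-tensor field `C`. -/
def lift0FormComp (C : E → E →L[ℝ] E →L[ℝ] ℝ) (u : E × E × E) :
    (E × E × E) →L[ℝ] (E × E × E) →L[ℝ] ℝ :=
  (C u.1).bilinearComp (ContinuousLinearMap.fst ℝ E (E × E)) (ContinuousLinearMap.fst ℝ E (E × E))

set_option maxSynthPendingDepth 3 in
/-- Components of the 2-nd lift of a `(0,2)`-tensor field `G` at `(x, y, z)`: the block matrix with
rows `(DG(x) z + ½ D²G(x)(y, y), DG(x) y, G)`, `(DG(x) y, G, 0)`, `(G, 0, 0)`. -/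
def lift2FormComp (G : E → E →L[ℝ] E →L[ℝ] ℝ) (u : E × E × E) :
    (E × E × E) →L[ℝ] (E × E × E) →L[ℝ] ℝ :=
  let q₀ : (E × E × E) →L[ℝ] E := ContinuousLinearMap.fst ℝ E (E × E)
  let q₁ : (E × E × E) →L[ℝ] E :=
    (ContinuousLinearMap.fst ℝ E E).comp (ContinuousLinearMap.snd ℝ E (E × E))
  let q₂ : (E × E × E) →L[ℝ] E :=
    (ContinuousLinearMap.snd ℝ E E).comp (ContinuousLinearMap.snd ℝ E (E × E))
  let G₀ : E →L[ℝ] E →L[ℝ] ℝ := G u.1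
  let G₁ : E →L[ℝ] E →L[ℝ] ℝ := fderiv ℝ G u.1 u.2.1
  let G₂ : E →L[ℝ] E →L[ℝ] ℝ :=
    fderiv ℝ G u.1 u.2.2 + (1 / 2 : ℝ) • fderiv ℝ (fderiv ℝ G) u.1 u.2.1 u.2.1
  G₂.bilinearComp q₀ q₀ + G₁.bilinearComp q₀ q₁ + G₀.bilinearComp q₀ q₂
    + G₁.bilinearComp q₁ q₀ + G₀.bilinearComp q₁ q₁ + G₀.bilinearComp q₂ q₀

variable {M : Type*} [TopologicalSpace M] [ChartedSpace E M] [IsManifold 𝓘(ℝ, E) ∞ M]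

/-- The induced chart of `T²M` around a point `p` that comes from the preferred chart of `M`. The
lifts below are defined by their components in this chart; since the formulas are invariant under
changes of induced coordinates, the components in every other induced chart have the same form. -/
def chartAround (p : SecondTangentBundle E M) :
    OpenPartialHomeomorph (SecondTangentBundle E M) (E × E × E) :=
  inducedChart (chartAt E (proj p)) (chart_mem_atlas E (proj p))

/-- The tangent vector at `p` with given components in induced coordinates. -/
def vecOfComp (p : SecondTangentBundle E M) (a : E × E × E) : TangentSpace 𝓘(ℝ, E × E × E) p :=
  (mfderiv 𝓘(ℝ, E × E × E) 𝓘(ℝ, E × E × E) (chartAround p) p).inverse a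

/-- The bilinear form on the tangent space at `p` with given components in induced coordinates. -/
def formOfComp (p : SecondTangentBundle E M) (B : (E × E × E) →L[ℝ] (E × E × E) →L[ℝ] ℝ) :
    TangentSpace 𝓘(ℝ, E × E × E) p →L[ℝ] TangentSpace 𝓘(ℝ, E × E × E) p →L[ℝ] ℝ :=
  let A : (E × E × E) →L[ℝ] (E × E × E) :=
    mfderiv 𝓘(ℝ, E × E × E) 𝓘(ℝ, E × E × E) (chartAround p) p
  B.bilinearComp A A

/-- The 0-th lift of a vector field to `T²M`. -/
def lift0 (X : Π q : M, TangentSpace 𝓘(ℝ, E) q) (p : SecondTangentBundle E M) :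
    TangentSpace 𝓘(ℝ, E × E × E) p :=
  vecOfComp p (lift0Comp (vecInChart (chartAt E (proj p)) X) (chartAround p p))

/-- The 1-st lift of a vector field to `T²M`. -/
def lift1 (X : Π q : M, TangentSpace 𝓘(ℝ, E) q) (p : SecondTangentBundle E M) :
    TangentSpace 𝓘(ℝ, E × E × E) p :=
  vecOfComp p (lift1Comp (vecInChart (chartAt E (proj p)) X) (chartAround p p))

/-- The 2-nd lift of a vector field to `T²M`. -/
def lift2 (X : Π q : M, TangentSpace 𝓘(ℝ, E) q) (p : SecondTangentBundle E M) :
    TangentSpace 𝓘(ℝ, E × E × E) p :=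
  vecOfComp p (lift2Comp (vecInChart (chartAt E (proj p)) X) (chartAround p p))

/-- The 0-th lift of a `(0,2)`-tensor field to `T²M`. -/
def lift0Form (c : Π q : M, TangentSpace 𝓘(ℝ, E) q →L[ℝ] TangentSpace 𝓘(ℝ, E) q →L[ℝ] ℝ)
    (p : SecondTangentBundle E M) :
    TangentSpace 𝓘(ℝ, E × E × E) p →L[ℝ] TangentSpace 𝓘(ℝ, E × E × E) p →L[ℝ] ℝ :=
  formOfComp p (lift0FormComp (formInChart (chartAt E (proj p)) c) (chartAround p p))

/-- The 2-nd lift of a `(0,2)`-tensor field to `T²M`. -/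
def lift2Form (g : Π q : M, TangentSpace 𝓘(ℝ, E) q →L[ℝ] TangentSpace 𝓘(ℝ, E) q →L[ℝ] ℝ)
    (p : SecondTangentBundle E M) :
    TangentSpace 𝓘(ℝ, E × E × E) p →L[ℝ] TangentSpace 𝓘(ℝ, E × E × E) p →L[ℝ] ℝ :=
  formOfComp p (lift2FormComp (formInChart (chartAt E (proj p)) g) (chartAround p p))

/-- The deformed 2-nd lift metric on `T²M`: the 2-nd lift of `g` plus the 0-th lift of `c`. -/
def deformedMetric (g : PseudoRiemannianMetric E M) (c : SymmetricTensor E M)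
    (p : SecondTangentBundle E M) :
    TangentSpace 𝓘(ℝ, E × E × E) p →L[ℝ] TangentSpace 𝓘(ℝ, E × E × E) p →L[ℝ] ℝ :=
  lift2Form g.val p + lift0Form c.val p

end Lifts

end SecondTangent

end

/-! A 2-jet `(x, y, z)` is read as the truncated curve `x + t y + t² z`, a point with coefficients
in `ℝ[t]/(t³)`, and `prolong f` is the action of `f` on such jets. All the lifted objects have this
shape. In coordinates the 2-nd lift of a field `V` is `prolong V`; the 1-st and 0-th lifts arise
from it by multiplying once or twice by `t` (`jetShift`); the 2-nd lift of `g` is the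
`t²`-coefficient of `g` evaluated along curves.

Differentiation commutes with prolongation (`fderiv_prolong`), so the Koszul formula for `g`,
applied at each point of a curve, yields the Koszul formula for the lifted metric. Hence the
Christoffel symbols of the deformed metric at `u, v, w` are the jet of `t ↦ Γ(u(t), v(t), w(t))`,
corrected by `(0, 0, H)` on account of `c` (`christoffel_deformedComp`). Inserting this into the Lie
derivative shows that, along the 2-nd lift, it is the jet of `L_X ∇` along curves plus `(0, 0, L_X
H)` (`lieDerivConnection_prolong`).

The lifted Christoffel symbols and their derivatives are linear over multiplication by `t`. For the
1-st and 0-th lifts the same expression is therefore multiplied by `t` or `t²`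
(`lieDerivConnection_shift`), which annihilates the `H` term. Constant jets recover `L_X ∇` from the
components `0`, `1`, `2` for the 2-nd, 1-st and 0-th lifts respectively; conversely, if `L_X ∇`
vanishes on the chart domain, all its jets vanish. For the 2-nd lift what then remains is `L_X H`.

Globally, the atlas of `T²M` consists exactly of the induced charts, whose transition maps are
prolongations. Naturality of prolongation gives the lifts the same components in each of them, so
the equivalences are checked one chart of `M` at a time, and no transformation law for the Lie
derivative is required. -/

noncomputable section
namespace SecondTangent


/-! ### Calculus of 2-jets: prolongation, products, derivatives, multiplication by the parameter. -/

section JetCalculus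

variable {D E F F' : Type*} [NormedAddCommGroup D] [NormedSpace ℝ D]
  [NormedAddCommGroup E] [NormedSpace ℝ E]
  [NormedAddCommGroup F] [NormedSpace ℝ F] [NormedAddCommGroup F'] [NormedSpace ℝ F']

theorem jetCurve_zero (u : E × E × E) : jetCurve u 0 = u.1 := by simp [jetCurve]

/-- Identities between prolongations reduce through this to pointwise identities along a curve. -/
theorem prolong_eq_curveJet {f : E → F} {u : E × E × E} (hf : ContDiffAt ℝ ∞ f u.1) :
    prolong f u = curveJet (fun t ↦ f (jetCurve u t)) := by
  have h := curveJet_comp (γ := jetCurve u) (by rwa [jetCurve_zero])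
    (contDiff_jetCurve u).contDiffAt
  rw [curveJet_jetCurve] at h
  exact h.symm

theorem curveJet_eq_prolong {f : E → F} {γ : ℝ → E} {u : E × E × E} (hγ : ContDiffAt ℝ ∞ γ 0)
    (h : curveJet γ = u) (hf : ContDiffAt ℝ ∞ f u.1) :
    curveJet (fun t ↦ f (γ t)) = prolong f u := by
  subst h
  exact curveJet_comp (f := f) hf hγ

theorem prolong_congr {f g : E → F} {u : E × E × E} (h : f =ᶠ[𝓝 u.1] g) :
    prolong f u = prolong g u := by
  simp only [prolong, h.eq_of_nhds, h.fderiv_eq, h.fderiv.fderiv_eq]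

theorem contDiffAt_prolong {f : E → F} {u : E × E × E} (hf : ContDiffAt ℝ ∞ f u.1) :
    ContDiffAt ℝ ∞ (prolong f) u := by
  have h1 : ContDiffAt ℝ ∞ (fun u : E × E × E ↦ f u.1) u := hf.comp u contDiffAt_fst
  have d1 : ContDiffAt ℝ ∞ (fderiv ℝ f) u.1 := hf.fderiv_right (by simp)
  have d2 : ContDiffAt ℝ ∞ (fderiv ℝ (fderiv ℝ f)) u.1 := d1.fderiv_right (by simp)
  have d1' : ContDiffAt ℝ ∞ (fun u : E × E × E ↦ fderiv ℝ f u.1) u := d1.comp u contDiffAt_fst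
  have d2' : ContDiffAt ℝ ∞ (fun u : E × E × E ↦ fderiv ℝ (fderiv ℝ f) u.1) u :=
    d2.comp u contDiffAt_fst
  unfold prolong
  refine h1.prodMk (ContDiffAt.prodMk ?_ ?_)
  · exact d1'.clm_apply (by fun_prop)
  · exact (d1'.clm_apply (by fun_prop)).add
      (contDiffAt_const.smul ((d2'.clm_apply (by fun_prop)).clm_apply (by fun_prop)))

/-- Functoriality of the jet construction: both sides are the jet of the curve `f ∘ g ∘ jetCurve u`,
so the second-order chain rule need not be expanded. -/
theorem prolong_comp {f : E → F} {g : D → E} {u : D × D × D} (hg : ContDiffAt ℝ ∞ g u.1)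
    (hf : ContDiffAt ℝ ∞ f (g u.1)) :
    prolong (fun x ↦ f (g x)) u = prolong f (prolong g u) := by
  have hγ : ContDiffAt ℝ ∞ (fun t ↦ g (jetCurve u t)) 0 :=
    ContDiffAt.comp (g := g) 0 (by rwa [jetCurve_zero]) (contDiff_jetCurve u).contDiffAt
  refine (prolong_eq_curveJet (ContDiffAt.comp (g := f) _ hf hg)).trans ?_
  exact curveJet_eq_prolong hγ (prolong_eq_curveJet hg).symm hf

theorem prolong_clm (L : E →L[ℝ] F) (u : E × E × E) :
    prolong L u = (L u.1, L u.2.1, L u.2.2) := by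
  have h : fderiv ℝ (L : E → F) = fun _ ↦ L := by funext x; exact L.fderiv
  simp [prolong, h]

/-- The 2-jet of a pair of curves. -/
def jetPair (u : E × E × E) (a : F × F × F) : (E × F) × (E × F) × (E × F) :=
  ((u.1, a.1), (u.2.1, a.2.1), (u.2.2, a.2.2))

theorem jetCurve_jetPair (u : E × E × E) (a : F × F × F) (t : ℝ) :
    jetCurve (jetPair u a) t = (jetCurve u t, jetCurve a t) := rfl

theorem jetPair_add_smul (u a : E × E × E) (b : F × F × F) (t : ℝ) :
    jetPair (u + t • a) b = jetPair u b + t • jetPair a 0 := by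
  simp [jetPair]

theorem prolong_fst (u : E × E × E) (a : F × F × F) :
    prolong (Prod.fst : E × F → E) (jetPair u a) = u :=
  prolong_clm (ContinuousLinearMap.fst ℝ E F) _

theorem prolong_id (u : E × E × E) : prolong (fun x : E ↦ x) u = u :=
  prolong_clm (ContinuousLinearMap.id ℝ E) _

theorem prolong_prodMk {f : D → E} {g : D → F} {u : D × D × D} (hf : ContDiffAt ℝ ∞ f u.1)
    (hg : ContDiffAt ℝ ∞ g u.1) :
    prolong (fun x ↦ (f x, g x)) u = jetPair (prolong f u) (prolong g u) := by
  have h1 := prolong_comp (f := (Prod.fst : E × F → E)) (hf.prodMk hg) contDiffAt_fst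
  have h2 := prolong_comp (f := (Prod.snd : E × F → F)) (hf.prodMk hg) contDiffAt_snd
  simp only at h1 h2
  rw [h1, h2]
  generalize prolong (fun x ↦ (f x, g x)) u = w
  rw [show (prolong (Prod.fst : E × F → E)) w = _ from
      prolong_clm (ContinuousLinearMap.fst ℝ E F) w,
    show (prolong (Prod.snd : E × F → F)) w = _ from
      prolong_clm (ContinuousLinearMap.snd ℝ E F) w]
  rfl

theorem prolong_add {f g : D → E} {u : D × D × D} (hf : ContDiffAt ℝ ∞ f u.1)
    (hg : ContDiffAt ℝ ∞ g u.1) :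
    prolong (fun x ↦ f x + g x) u = prolong f u + prolong g u := by
  have h1 := prolong_comp (f := (ContinuousLinearMap.fst ℝ E E + ContinuousLinearMap.snd ℝ E E))
    (hf.prodMk hg) (ContinuousLinearMap.contDiff _).contDiffAt
  rw [prolong_clm, prolong_prodMk hf hg] at h1
  exact h1

theorem prolong_sub {f g : D → E} {u : D × D × D} (hf : ContDiffAt ℝ ∞ f u.1)
    (hg : ContDiffAt ℝ ∞ g u.1) :
    prolong (fun x ↦ f x - g x) u = prolong f u - prolong g u := by
  have h1 := prolong_comp (f := (ContinuousLinearMap.fst ℝ E E - ContinuousLinearMap.snd ℝ E E))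
    (hf.prodMk hg) (ContinuousLinearMap.contDiff _).contDiffAt
  rw [prolong_clm, prolong_prodMk hf hg] at h1
  exact h1

theorem contDiffAt_two_of_infty {f : E → F} {x : E} (hf : ContDiffAt ℝ ∞ f x) :
    ContDiffAt ℝ 2 f x := by
  exact_mod_cast contDiffAt_infty.1 hf 2

theorem contDiffAt_fderiv_apply {f : E → F} {p : E × E} (hf : ContDiffAt ℝ ∞ f p.1) :
    ContDiffAt ℝ ∞ (fun p : E × E ↦ fderiv ℝ f p.1 p.2) p :=
  ContDiffAt.clm_apply (f := fun p : E × E ↦ fderiv ℝ f p.1)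
    (ContDiffAt.comp (g := fderiv ℝ f) p (hf.fderiv_right (by simp)) contDiffAt_fst) contDiffAt_snd

theorem hasDerivAt_line (u a : E) : HasDerivAt (fun s : ℝ ↦ u + s • a) a 0 := by
  simpa using ((hasDerivAt_id (0 : ℝ)).smul_const a).const_add u

/-- Reduces a Fréchet derivative in a known direction to a one-variable derivative, where product
rules are easy to apply. -/
theorem fderiv_apply_eq_of_line {f : E → F} {u a : E} {b : F} (hf : DifferentiableAt ℝ f u)
    (h : HasDerivAt (fun s : ℝ ↦ f (u + s • a)) b 0) : fderiv ℝ f u a = b := by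
  have h0 : HasFDerivAt f (fderiv ℝ f u) (u + (0 : ℝ) • a) := by simpa using hf.hasFDerivAt
  exact (h0.comp_hasDerivAt 0 (hasDerivAt_line u a)).unique h

theorem hasDerivAt_comp_line {f : E → F} {u a : E} (hf : ContDiffAt ℝ ∞ f u) :
    HasDerivAt (fun s : ℝ ↦ f (u + s • a)) (fderiv ℝ f u a) 0 := by
  have h0 : HasFDerivAt f (fderiv ℝ f u) (u + (0 : ℝ) • a) := by
    simpa using (hf.differentiableAt (by simp)).hasFDerivAt
  exact h0.comp_hasDerivAt 0 (SecondTangent.hasDerivAt_line u a)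

theorem fderiv_fderiv_apply {f : E → F} {p q : E × E} (hf : ContDiffAt ℝ 2 f p.1) :
    fderiv ℝ (fun p : E × E ↦ fderiv ℝ f p.1 p.2) p q =
      fderiv ℝ (fderiv ℝ f) p.1 q.1 p.2 + fderiv ℝ f p.1 q.2 := by
  have h : HasFDerivAt (fderiv ℝ f) (fderiv ℝ (fderiv ℝ f) p.1) p.1 :=
    ((hf.fderiv_right (m := 1) (by norm_num)).differentiableAt (by simp)).hasFDerivAt
  have h' : HasFDerivAt (fun p : E × E ↦ fderiv ℝ f p.1) _ p := h.comp p hasFDerivAt_fst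
  rw [(h'.clm_apply hasFDerivAt_snd).fderiv]
  simp [add_comm]

/-- The differential of the jet map is the jet of the differential: this is the canonical exchange
of `T(T²)` with `T²(T)`. It expresses the symmetry of the second and third derivatives of `f`, since
the derivative along `a` and the derivatives along the curve may be taken in either order. -/
theorem fderiv_prolong {f : E → F} {u : E × E × E} (hf : ContDiffAt ℝ ∞ f u.1)
    (a : E × E × E) :
    fderiv ℝ (prolong f) u a = prolong (fun p : E × E ↦ fderiv ℝ f p.1 p.2) (jetPair u a) := by
  have d1 : ContDiffAt ℝ ∞ (fderiv ℝ f) u.1 := hf.fderiv_right (by simp)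
  have d2 : ContDiffAt ℝ ∞ (fderiv ℝ (fderiv ℝ f)) u.1 := d1.fderiv_right (by simp)
  have e1 : ∀ v w, fderiv ℝ (fderiv ℝ f) u.1 v w = fderiv ℝ (fderiv ℝ f) u.1 w v :=
    (contDiffAt_two_of_infty hf).isSymmSndFDerivAt (by simp)
  have e2 : ∀ v w, fderiv ℝ (fderiv ℝ (fderiv ℝ f)) u.1 v w =
      fderiv ℝ (fderiv ℝ (fderiv ℝ f)) u.1 w v :=
    (contDiffAt_two_of_infty d1).isSymmSndFDerivAt (by simp)
  -- Symmetry in the last two slots comes from differentiating the symmetry of the second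
  -- derivative, which holds in a neighbourhood.
  have e3 : ∀ b v w, fderiv ℝ (fderiv ℝ (fderiv ℝ f)) u.1 b v w =
      fderiv ℝ (fderiv ℝ (fderiv ℝ f)) u.1 b w v := by
    intro b v w
    have hd := (d2.differentiableAt (by simp)).hasFDerivAt
    have k1 : ∀ v w, HasFDerivAt (fun x ↦ fderiv ℝ (fderiv ℝ f) x v w) _ u.1 := fun v w ↦
      (hd.clm_apply (hasFDerivAt_const v u.1)).clm_apply (hasFDerivAt_const w u.1)
    have k2 : (fun x ↦ fderiv ℝ (fderiv ℝ f) x v w) =ᶠ[𝓝 u.1]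
        (fun x ↦ fderiv ℝ (fderiv ℝ f) x w v) := by
      filter_upwards [(contDiffAt_two_of_infty hf).eventually (by decide)]
        with x hx
      exact hx.isSymmSndFDerivAt (by simp) v w
    have k3 := k2.fderiv_eq (𝕜 := ℝ)
    rw [(k1 v w).fderiv, (k1 w v).fderiv] at k3
    simpa using congrArg (fun L : E →L[ℝ] F ↦ L b) k3
  have hl := hasDerivAt_comp_line d1 (a := a.1)
  have hl2 := hasDerivAt_comp_line d2 (a := a.1)
  have hy := hasDerivAt_line u.2.1 a.2.1
  have hz := hasDerivAt_line u.2.2 a.2.2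
  have key := fderiv_apply_eq_of_line (a := a)
    ((contDiffAt_prolong hf).differentiableAt (by simp))
    ((hasDerivAt_comp_line hf (a := a.1)).prodMk ((hl.clm_apply hy).prodMk
      ((hl.clm_apply hz).add (((hl2.clm_apply hy).clm_apply hy).const_smul (1 / 2 : ℝ)))))
  rw [key]
  -- The factor `2` counts the two ways in which one derivative falls on the point and the other on
  -- the direction; there is no term with both on the direction, because `Df(x)ξ` is linear in `ξ`.
  have g2 : fderiv ℝ (fderiv ℝ fun p : E × E ↦ fderiv ℝ f p.1 p.2) (u.1, a.1) (u.2.1, a.2.1)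
      (u.2.1, a.2.1) = fderiv ℝ (fderiv ℝ (fderiv ℝ f)) u.1 u.2.1 u.2.1 a.1
        + (2 : ℝ) • fderiv ℝ (fderiv ℝ f) u.1 u.2.1 a.2.1 := by
    have c1 : ContDiffAt ℝ ∞ (fderiv ℝ fun p : E × E ↦ fderiv ℝ f p.1 p.2) (u.1, a.1) :=
      (contDiffAt_fderiv_apply (p := (u.1, a.1)) hf).fderiv_right (by simp)
    have c2 := hasDerivAt_comp_line c1 (a := (u.2.1, a.2.1))
    have c3 := c2.clm_apply (hasDerivAt_const (0 : ℝ) ((u.2.1, a.2.1) : E × E))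
    have c4 := (((hasDerivAt_comp_line d2 (a := u.2.1)).clm_apply
      (hasDerivAt_const (0 : ℝ) u.2.1)).clm_apply (hasDerivAt_line a.1 a.2.1)).add
        ((hasDerivAt_comp_line d1 (a := u.2.1)).clm_apply (hasDerivAt_const (0 : ℝ) a.2.1))
    have c5 := c4.congr_of_eventuallyEq (f₁ := fun s : ℝ ↦
      (fderiv ℝ fun p : E × E ↦ fderiv ℝ f p.1 p.2) ((u.1, a.1) + s • (u.2.1, a.2.1))
        (u.2.1, a.2.1)) (by
      have c6 : ∀ᶠ s : ℝ in 𝓝 0, ContDiffAt ℝ 2 f (u.1 + s • u.2.1) := by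
        have : ContinuousAt (fun s : ℝ ↦ u.1 + s • u.2.1) 0 := by fun_prop
        refine this.eventually ?_
        simp only [zero_smul, add_zero]
        exact (contDiffAt_two_of_infty hf).eventually (by decide)
      filter_upwards [c6] with s hs
      exact fderiv_fderiv_apply (p := (u.1, a.1) + s • (u.2.1, a.2.1)) hs)
    have c7 := c3.unique c5
    simp only [map_zero, add_zero, zero_smul] at c7
    rw [c7, two_smul, add_assoc]
  have hf2 : ContDiffAt ℝ 2 f u.1 := contDiffAt_two_of_infty hf
  refine Prod.ext ?_ (Prod.ext ?_ ?_)
  · simp [prolong, jetPair]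
  · simp only [prolong, jetPair, fderiv_fderiv_apply (p := (u.1, a.1)) hf2, zero_smul, add_zero]
    rw [e1]
  · simp only [prolong, jetPair, fderiv_fderiv_apply (p := (u.1, a.1)) hf2, zero_smul, add_zero,
      g2, add_apply]
    rw [e1 u.2.2 a.1, e1 u.2.1 a.2.1, e2 a.1 u.2.1, e3 u.2.1 a.1, smul_add, smul_add, smul_add,
      smul_smul, e1 a.2.1 u.2.1]
    module

/-- `fderiv_prolong` in the direction `jetPair a 0`, with the second jet frozen. -/
theorem fderiv_prolong_left {f : E × F → F'} {u : E × E × E} {b : F × F × F}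
    (hf : ContDiffAt ℝ ∞ f (u.1, b.1)) (a : E × E × E) :
    fderiv ℝ (fun u ↦ prolong f (jetPair u b)) u a =
      prolong (fun p : E × E × F ↦ fderiv ℝ f (p.1, p.2.2) (p.2.1, 0))
        (jetPair u (jetPair a b)) := by
  have h1 : HasDerivAt (fun s : ℝ ↦ prolong f (jetPair (u + s • a) b))
      (fderiv ℝ (prolong f) (jetPair u b) (jetPair a 0)) 0 := by
    have := hasDerivAt_comp_line (contDiffAt_prolong (u := jetPair u b) hf) (a := jetPair a 0)
    refine this.congr_of_eventuallyEq (Filter.Eventually.of_forall fun s ↦ ?_)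
    simp only [jetPair_add_smul]
  have h2 : ContDiffAt ℝ ∞ (fun u : E × E × E ↦ prolong f (jetPair u b)) u := by
    refine ContDiffAt.comp (g := prolong f) (f := fun u : E × E × E ↦ jetPair u b) u
      (contDiffAt_prolong (u := jetPair u b) hf) ?_
    unfold jetPair
    fun_prop
  rw [fderiv_apply_eq_of_line (h2.differentiableAt (by simp)) h1, fderiv_prolong hf]
  have h3 := prolong_comp (g := fun p : E × E × F ↦ ((p.1, p.2.2), (p.2.1, (0 : F))))
    (u := jetPair u (jetPair a b)) (f := fun q : (E × F) × (E × F) ↦ fderiv ℝ f q.1 q.2)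
    (by fun_prop) (contDiffAt_fderiv_apply hf)
  rw [h3]
  congr 1
  -- The substitution `(x, a, b) ↦ ((x, b), (a, 0))` is linear, so its prolongation merely
  -- rearranges the jets.
  let L : E × E × F →L[ℝ] (E × F) × (E × F) :=
    ((ContinuousLinearMap.fst ℝ E (E × F)).prod
      ((ContinuousLinearMap.snd ℝ E F).comp (ContinuousLinearMap.snd ℝ E (E × F)))).prod
    (((ContinuousLinearMap.fst ℝ E F).comp (ContinuousLinearMap.snd ℝ E (E × F))).prod 0)
  exact (prolong_clm L (jetPair u (jetPair a b))).symm

/-- Multiplication of power series modulo `t³`; the normalisation `½ γ''` of the last component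
makes all binomial factors disappear. -/
theorem prolong_bilinear (B : E →L[ℝ] F →L[ℝ] F') (u : E × E × E) (a : F × F × F) :
    prolong (fun p : E × F ↦ B p.1 p.2) (jetPair u a) =
      (B u.1 a.1, B u.1 a.2.1 + B u.2.1 a.1, B u.1 a.2.2 + B u.2.1 a.2.1 + B u.2.2 a.1) := by
  have h1 : fderiv ℝ (fun p : E × F ↦ B p.1 p.2) = B.deriv₂ := by
    funext p
    exact (B.isBoundedBilinearMap.hasFDerivAt p).fderiv
  simp only [prolong, jetPair, h1, ContinuousLinearMap.fderiv, ContinuousLinearMap.coe_deriv₂,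
    Prod.mk.injEq, true_and]
  module

theorem prolong_clm_apply {A : D → E →L[ℝ] F} {f : D → E} {u : D × D × D}
    (hA : ContDiffAt ℝ ∞ A u.1) (hf : ContDiffAt ℝ ∞ f u.1) :
    prolong (fun x ↦ A x (f x)) u =
      ((prolong A u).1 (prolong f u).1,
        (prolong A u).1 (prolong f u).2.1 + (prolong A u).2.1 (prolong f u).1,
        (prolong A u).1 (prolong f u).2.2 + (prolong A u).2.1 (prolong f u).2.1
          + (prolong A u).2.2 (prolong f u).1) := by
  have h := prolong_comp (f := fun q : (E →L[ℝ] F) × E ↦ q.1 q.2) (hA.prodMk hf) (by fun_prop)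
  rw [prolong_prodMk hA hf] at h
  exact h.trans (prolong_bilinear (ContinuousLinearMap.id ℝ (E →L[ℝ] F)) _ _)

/-- Multiplication of a 2-jet by the parameter of the curve. -/
def jetShift : (E × E × E) →L[ℝ] (E × E × E) :=
  (0 : (E × E × E) →L[ℝ] E).prod ((ContinuousLinearMap.fst ℝ E (E × E)).prod
    ((ContinuousLinearMap.fst ℝ E E).comp (ContinuousLinearMap.snd ℝ E (E × E))))

@[simp]
theorem jetShift_apply (a : E × E × E) : jetShift a = (0, a.1, a.2.1) := rfl

/-- `(0, 1, 0)` is the jet of `t ↦ t`. Rules for `prolong` thus become rules for `curveJet`. -/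
theorem prolong_unit {γ : ℝ → E} (hγ : ContDiffAt ℝ ∞ γ 0) :
    prolong γ ((0, 1, 0) : ℝ × ℝ × ℝ) = curveJet γ := by
  rw [prolong_eq_curveJet hγ]
  congr 1
  funext t
  simp [jetCurve]

theorem curveJet_prodMk {γ : ℝ → E} {δ : ℝ → F} (hγ : ContDiffAt ℝ ∞ γ 0)
    (hδ : ContDiffAt ℝ ∞ δ 0) :
    curveJet (fun t ↦ (γ t, δ t)) = jetPair (curveJet γ) (curveJet δ) := by
  have := prolong_prodMk (u := ((0, 1, 0) : ℝ × ℝ × ℝ)) hγ hδ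
  rwa [prolong_unit hγ, prolong_unit hδ, prolong_unit (hγ.prodMk hδ)] at this

theorem curveJet_smul {γ : ℝ → E} (hγ : ContDiffAt ℝ ∞ γ 0) :
    curveJet (fun t ↦ t • γ t) = jetShift (curveJet γ) := by
  have hid : ContDiffAt ℝ ∞ (fun t : ℝ ↦ t) 0 := contDiffAt_id
  have h : curveJet (fun t : ℝ ↦ (t, γ t)) = jetPair ((0, 1, 0) : ℝ × ℝ × ℝ) (curveJet γ) := by
    rw [curveJet_prodMk hid hγ, ← prolong_unit hid, prolong_id]
  rw [curveJet_eq_prolong (f := fun p : ℝ × E ↦ p.1 • p.2) (hid.prodMk hγ) h (by fun_prop)]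
  refine (prolong_bilinear (ContinuousLinearMap.lsmul ℝ ℝ) _ _).trans ?_
  simp

/-- Homogeneity of `f` along a curve becomes multiplication by `t` on jets. -/
theorem prolong_shift {f : E → F} {u v : E × E × E}
    (hu : ContDiffAt ℝ ∞ f u.1) (hv : ContDiffAt ℝ ∞ f v.1) {δ : ℝ → E}
    (hδ : ContDiffAt ℝ ∞ δ 0) (h : curveJet δ = v)
    (hf : ∀ᶠ t in 𝓝 (0 : ℝ), f (δ t) = t • f (jetCurve u t)) :
    prolong f v = jetShift (prolong f u) := by
  rw [← curveJet_eq_prolong hδ h hv, curveJet_congr hf, prolong_eq_curveJet hu]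
  exact curveJet_smul (ContDiffAt.comp (g := f) 0 (by rwa [jetCurve_zero])
    (contDiff_jetCurve u).contDiffAt)

theorem curveJet_smul_jetCurve (a : E × E × E) :
    curveJet (fun t ↦ t • jetCurve a t) = jetShift a := by
  rw [curveJet_smul (contDiff_jetCurve a).contDiffAt, curveJet_jetCurve]

theorem curveJet_add {γ δ : ℝ → E} (hγ : ContDiffAt ℝ ∞ γ 0) (hδ : ContDiffAt ℝ ∞ δ 0) :
    curveJet (fun t ↦ γ t + δ t) = curveJet γ + curveJet δ := by
  have := prolong_add (u := ((0, 1, 0) : ℝ × ℝ × ℝ)) hγ hδ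
  rwa [prolong_unit hγ, prolong_unit hδ, prolong_unit (hγ.add hδ)] at this

theorem curveJet_sub {γ δ : ℝ → E} (hγ : ContDiffAt ℝ ∞ γ 0) (hδ : ContDiffAt ℝ ∞ δ 0) :
    curveJet (fun t ↦ γ t - δ t) = curveJet γ - curveJet δ := by
  have := prolong_sub (u := ((0, 1, 0) : ℝ × ℝ × ℝ)) hγ hδ
  rwa [prolong_unit hγ, prolong_unit hδ, prolong_unit (hγ.sub hδ)] at this

/-- Any curves with the given jets may be used. This freedom matters because the curves that occur
later, such as `t ↦ V (jetCurve u t)`, are not polynomial. -/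
theorem prolong_jetPair {f : E × F → F'} {u : E × E × E} {a : F × F × F} {γ : ℝ → E} {δ : ℝ → F}
    (hf : ContDiffAt ℝ ∞ f (u.1, a.1)) (hγ : ContDiffAt ℝ ∞ γ 0) (hδ : ContDiffAt ℝ ∞ δ 0)
    (hu : curveJet γ = u) (ha : curveJet δ = a) :
    prolong f (jetPair u a) = curveJet (fun t ↦ f (γ t, δ t)) :=
  (curveJet_eq_prolong (hγ.prodMk hδ) (by rw [curveJet_prodMk hγ hδ, hu, ha]) hf).symm

theorem prolong_jetPair₃ {f : D × E × F → F'} {r : D × D × D} {u : E × E × E} {a : F × F × F}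
    {β : ℝ → D} {γ : ℝ → E} {δ : ℝ → F}
    (hf : ContDiffAt ℝ ∞ f (r.1, u.1, a.1)) (hβ : ContDiffAt ℝ ∞ β 0) (hγ : ContDiffAt ℝ ∞ γ 0)
    (hδ : ContDiffAt ℝ ∞ δ 0) (hr : curveJet β = r) (hu : curveJet γ = u) (ha : curveJet δ = a) :
    prolong f (jetPair r (jetPair u a)) = curveJet (fun t ↦ f (β t, γ t, δ t)) :=
  prolong_jetPair (a := jetPair u a) hf hβ (hγ.prodMk hδ) hr (by rw [curveJet_prodMk hγ hδ, hu, ha])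

theorem contDiffAt_jetCurve (u : E × E × E) : ContDiffAt ℝ ∞ (jetCurve u) 0 :=
  (contDiff_jetCurve u).contDiffAt

theorem contDiffAt_smul_jetCurve (u : E × E × E) :
    ContDiffAt ℝ ∞ (fun t : ℝ ↦ t • jetCurve u t) 0 :=
  contDiffAt_id.smul (contDiffAt_jetCurve u)

theorem eventually_jetCurve_mem {s : Set E} (hs : IsOpen s) {u : E × E × E} (hu : u.1 ∈ s) :
    ∀ᶠ t in 𝓝 (0 : ℝ), jetCurve u t ∈ s :=
  (contDiff_jetCurve u).continuous.continuousAt.preimage_mem_nhds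
    (hs.mem_nhds (by rwa [jetCurve_zero]))

/-- The differential of a prolongation commutes with the multiplication by the parameter. -/
theorem fderiv_prolong_jetShift {f : E → F} {u : E × E × E} (hf : ContDiffAt ℝ ∞ f u.1)
    (a : E × E × E) :
    fderiv ℝ (prolong f) u (jetShift a) = jetShift (fderiv ℝ (prolong f) u a) := by
  rw [fderiv_prolong hf, fderiv_prolong hf]
  refine prolong_shift (contDiffAt_fderiv_apply hf) (contDiffAt_fderiv_apply hf)
    (δ := fun t ↦ (jetCurve u t, t • jetCurve a t)) ?_ ?_ ?_
  · exact (contDiffAt_jetCurve u).prodMk (contDiffAt_smul_jetCurve a)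
  · rw [curveJet_prodMk (contDiffAt_jetCurve u) (contDiffAt_smul_jetCurve a),
      curveJet_jetCurve, curveJet_smul_jetCurve]
  · exact Filter.Eventually.of_forall fun t ↦ by simp [jetCurve_jetPair]

theorem fderiv_prolong_fst {f : E → F} {u : E × E × E} (hf : ContDiffAt ℝ ∞ f u.1)
    (a : E × E × E) : (fderiv ℝ (prolong f) u a).1 = fderiv ℝ f u.1 a.1 := by
  rw [fderiv_prolong hf]; rfl

/-- A vertical vector is `t²` times a constant jet, and `t²` passes through the differential. -/
theorem fderiv_prolong_vertical {f : E → F} {u : E × E × E} (hf : ContDiffAt ℝ ∞ f u.1) (a : E) :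
    fderiv ℝ (prolong f) u (0, 0, a) = (0, 0, fderiv ℝ f u.1 a) := by
  have : ((0, 0, a) : E × E × E) = jetShift (jetShift (a, 0, 0)) := rfl
  rw [this, fderiv_prolong_jetShift hf, fderiv_prolong_jetShift hf]
  simp [fderiv_prolong_fst hf]

/-- Two applications of the exchange of differential and prolongation; the second keeps the jet `w`
fixed. -/
theorem fderiv_fderiv_prolong {s : Set E} (hs : IsOpen s) {f : E → F} (hf : ContDiffOn ℝ ∞ f s)
    {u : E × E × E} (hu : u.1 ∈ s) (v w : E × E × E) :
    fderiv ℝ (fderiv ℝ (prolong f)) u v w =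
      curveJet fun t ↦ fderiv ℝ (fderiv ℝ f) (jetCurve u t) (jetCurve v t) (jetCurve w t) := by
  have hf' : ∀ x ∈ s, ContDiffAt ℝ ∞ f x := fun x hx ↦ hf.contDiffAt (hs.mem_nhds hx)
  have hd : DifferentiableAt ℝ (fderiv ℝ (prolong f)) u :=
    ((contDiffAt_prolong (hf' _ hu)).fderiv_right (m := ∞) (by simp)).differentiableAt (by simp)
  have h1 : fderiv ℝ (fun u' ↦ fderiv ℝ (prolong f) u' w) u v =
      fderiv ℝ (fderiv ℝ (prolong f)) u v w := by
    rw [(hd.hasFDerivAt.clm_apply (hasFDerivAt_const w u)).fderiv]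
    simp
  have h2 : (fun u' ↦ fderiv ℝ (prolong f) u' w) =ᶠ[𝓝 u]
      fun u' ↦ prolong (fun p : E × E ↦ fderiv ℝ f p.1 p.2) (jetPair u' w) := by
    filter_upwards [(hs.preimage continuous_fst).mem_nhds hu] with u' hu'
    exact fderiv_prolong (hf' _ hu') w
  have hc : ContDiffAt ℝ ∞ (fun p : E × E ↦ fderiv ℝ f p.1 p.2) (u.1, w.1) :=
    contDiffAt_fderiv_apply (hf' _ hu)
  rw [← h1, h2.fderiv_eq, fderiv_prolong_left hc]
  rw [prolong_jetPair₃ _ (contDiffAt_jetCurve u) (contDiffAt_jetCurve v) (contDiffAt_jetCurve w)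
    (curveJet_jetCurve u) (curveJet_jetCurve v) (curveJet_jetCurve w)]
  · refine curveJet_congr ?_
    filter_upwards [eventually_jetCurve_mem hs hu] with t ht
    rw [fderiv_fderiv_apply (contDiffAt_two_of_infty (hf' _ ht))]
    simp
  · exact ContDiffAt.comp (f := fun p : E × E × E ↦ ((p.1, p.2.2), (p.2.1, (0 : E))))
      (g := fun q : (E × E) × (E × E) ↦ fderiv ℝ (fun p : E × E ↦ fderiv ℝ f p.1 p.2) q.1 q.2) _
      (contDiffAt_fderiv_apply hc) (by fun_prop)

/-- The partial derivative of the prolongation of `f`, by means of curves. -/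
theorem fderiv_prolong_left_eq_curveJet {s : Set E} (hs : IsOpen s) {f : E × F → F'}
    (hf : ∀ p : E × F, p.1 ∈ s → ContDiffAt ℝ ∞ f p) {u : E × E × E} (hu : u.1 ∈ s)
    (b : F × F × F) {a : E × E × E} {α : ℝ → E} (hα : ContDiffAt ℝ ∞ α 0) (ha : curveJet α = a) :
    fderiv ℝ (fun u ↦ prolong f (jetPair u b)) u a =
      curveJet fun t ↦ fderiv ℝ (fun x ↦ f (x, jetCurve b t)) (jetCurve u t) (α t) := by
  rw [fderiv_prolong_left (hf (u.1, b.1) hu)]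
  rw [prolong_jetPair₃ _ (contDiffAt_jetCurve u) hα (contDiffAt_jetCurve b)
    (curveJet_jetCurve u) ha (curveJet_jetCurve b)]
  · refine curveJet_congr ?_
    filter_upwards [eventually_jetCurve_mem hs hu] with t ht
    have h1 := ((hf (jetCurve u t, jetCurve b t) ht).differentiableAt (by simp)).hasFDerivAt
    have h2 : HasFDerivAt (fun x : E ↦ f (x, jetCurve b t)) _ (jetCurve u t) :=
      h1.comp (jetCurve u t) ((hasFDerivAt_id _).prodMk (hasFDerivAt_const _ _))
    rw [h2.fderiv]
    simp
  · exact ContDiffAt.comp (f := fun p : E × E × F ↦ ((p.1, p.2.2), (p.2.1, (0 : F))))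
      (g := fun q : (E × F) × (E × F) ↦ fderiv ℝ f q.1 q.2) _
      (contDiffAt_fderiv_apply (hf (u.1, b.1) hu)) (by fun_prop)

end JetCalculus


/-! ### Raising an index with a nondegenerate form, and its smooth dependence on parameters. -/

section Sharp

variable {P F : Type*} [NormedAddCommGroup P] [NormedSpace ℝ P]
  [NormedAddCommGroup F] [NormedSpace ℝ F]

theorem sharp_eq {B : F →L[ℝ] F →L[ℝ] ℝ} (hB : ∀ v, (∀ w, B v w = 0) → v = 0) {φ : F → ℝ} {a : F}
    (h : ∀ b, B a b = φ b) : sharp B φ = a := by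
  have h1 : ∀ b, B (sharp B φ) b = φ b :=
    Classical.epsilon_spec (p := fun a ↦ ∀ b, B a b = φ b) ⟨a, h⟩
  refine sub_eq_zero.1 (hB _ fun b ↦ ?_)
  simp [h1, h]

variable [FiniteDimensional ℝ F]

/-- A nondegenerate form on a finite-dimensional space as an isomorphism onto the dual space. -/
def dualEquiv (B : F →L[ℝ] F →L[ℝ] ℝ) (hB : ∀ v, (∀ w, B v w = 0) → v = 0) :
    F ≃L[ℝ] (F →L[ℝ] ℝ) :=
  (LinearEquiv.ofInjectiveOfFinrankEq (B : F →ₗ[ℝ] F →L[ℝ] ℝ)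
    ((injective_iff_map_eq_zero _).2 fun v hv ↦ hB v fun w ↦ by
      simpa using congrArg (fun L : F →L[ℝ] ℝ ↦ L w) hv)
    (by rw [← (LinearMap.toContinuousLinearMap (𝕜 := ℝ) (E := F) (F' := ℝ)).finrank_eq]
        exact (Subspace.dual_finrank_eq (K := ℝ) (V := F)).symm)).toContinuousLinearEquiv

theorem coe_dualEquiv (B : F →L[ℝ] F →L[ℝ] ℝ) (hB : ∀ v, (∀ w, B v w = 0) → v = 0) :
    (dualEquiv B hB : F →L[ℝ] F →L[ℝ] ℝ) = B := by
  ext; rfl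

theorem sharp_spec {B : F →L[ℝ] F →L[ℝ] ℝ} (hB : ∀ v, (∀ w, B v w = 0) → v = 0) {φ : F → ℝ}
    (hφ : IsLinearMap ℝ φ) (b : F) : B (sharp B φ) b = φ b := by
  let L : F →L[ℝ] ℝ := LinearMap.toContinuousLinearMap (hφ.mk' φ)
  have h : ∀ b, B ((dualEquiv B hB).symm L) b = φ b := by
    intro b
    have : (dualEquiv B hB) ((dualEquiv B hB).symm L) = L := by simp
    exact congrArg (fun L : F →L[ℝ] ℝ ↦ L b) this
  rw [sharp_eq hB h, h]

theorem sharp_smul {B : F →L[ℝ] F →L[ℝ] ℝ} (hB : ∀ v, (∀ w, B v w = 0) → v = 0) {φ ψ : F → ℝ}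
    (hφ : IsLinearMap ℝ φ) {t : ℝ} (h : ∀ b, ψ b = t * φ b) : sharp B ψ = t • sharp B φ :=
  sharp_eq hB fun b ↦ by simp [sharp_spec hB hφ, h]

/-- Locally `sharp` is the inverse of `B q` applied to `φ q`, and inversion is smooth at invertible
operators. -/
theorem contDiffAt_sharp {B : P → F →L[ℝ] F →L[ℝ] ℝ} {φ : P → F → ℝ} {p : P}
    (hB : ContDiffAt ℝ ∞ B p) (hnd : ∀ᶠ q in 𝓝 p, ∀ v, (∀ w, B q v w = 0) → v = 0)
    (hlin : ∀ᶠ q in 𝓝 p, IsLinearMap ℝ (φ q)) (hφ : ∀ b, ContDiffAt ℝ ∞ (fun q ↦ φ q b) p) :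
    ContDiffAt ℝ ∞ (fun q ↦ sharp (B q) (φ q)) p := by
  let e := Module.finBasis ℝ F
  let c : Fin (Module.finrank ℝ F) → (F →L[ℝ] ℝ) :=
    fun i ↦ LinearMap.toContinuousLinearMap (e.coord i)
  -- The functional is expanded in a dual basis, which turns smoothness of each value `φ q b` into
  -- smoothness of a map into the dual space.
  have h1 : ContDiffAt ℝ ∞ (fun q ↦ ∑ i, φ q (e i) • c i) p :=
    ContDiffAt.sum fun i _ ↦ (hφ (e i)).smul contDiffAt_const
  have h2 : ContDiffAt ℝ ∞ (fun q ↦ ContinuousLinearMap.inverse (B q)) p := by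
    refine ContDiffAt.comp (g := ContinuousLinearMap.inverse) p ?_ hB
    rw [← coe_dualEquiv (B p) hnd.self_of_nhds]
    exact contDiffAt_map_inverse _
  refine (h2.clm_apply h1).congr_of_eventuallyEq ?_
  filter_upwards [hnd, hlin] with q hq hl
  refine sharp_eq hq fun b ↦ ?_
  have h3 : B q (ContinuousLinearMap.inverse (B q) (∑ i, φ q (e i) • c i)) =
      ∑ i, φ q (e i) • c i := by
    conv_lhs => rw [← coe_dualEquiv (B q) hq]
    simp only [ContinuousLinearMap.inverse_equiv]
    exact (dualEquiv (B q) hq).apply_symm_apply _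
  rw [h3]
  have h4 := congrArg (hl.mk' (φ q)) (e.sum_repr b)
  simp only [map_sum, map_smul, IsLinearMap.mk'_apply] at h4
  rw [← h4, sum_apply]
  exact Finset.sum_congr rfl fun i _ ↦ mul_comm _ _

end Sharp

/-! ### Christoffel symbols and the tensor `H` on an open subset of a vector space. -/

section LocalGeometry

variable {E : Type*} [NormedAddCommGroup E] [NormedSpace ℝ E]

/-- The components of a smooth symmetric `(0,2)`-tensor field on an open subset of a vector
space. -/
structure IsSymmetricOn (C : E → E →L[ℝ] E →L[ℝ] ℝ) (s : Set E) : Prop where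
  isOpen : IsOpen s
  contDiffOn : ContDiffOn ℝ ∞ C s
  symm : ∀ x ∈ s, ∀ v w, C x v w = C x w v

/-- The components of a pseudo-Riemannian metric on an open subset of a vector space. -/
structure IsMetricOn (G : E → E →L[ℝ] E →L[ℝ] ℝ) (s : Set E) : Prop extends IsSymmetricOn G s where
  nondegenerate : ∀ x ∈ s, ∀ v, (∀ w, G x v w = 0) → v = 0

variable {G C : E → E →L[ℝ] E →L[ℝ] ℝ} {V : E → E} {s : Set E}

theorem IsSymmetricOn.contDiffAt (hC : IsSymmetricOn C s) {x : E} (hx : x ∈ s) :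
    ContDiffAt ℝ ∞ C x := hC.contDiffOn.contDiffAt (hC.isOpen.mem_nhds hx)

theorem fderiv_clm_apply₂ {P E F F' : Type*} [NormedAddCommGroup P] [NormedSpace ℝ P]
    [NormedAddCommGroup E] [NormedSpace ℝ E]
    [NormedAddCommGroup F] [NormedSpace ℝ F] [NormedAddCommGroup F'] [NormedSpace ℝ F']
    {B : P → E →L[ℝ] F →L[ℝ] F'} {p : P} (hB : DifferentiableAt ℝ B p) (v : E) (w : F) (q : P) :
    fderiv ℝ (fun p ↦ B p v w) p q = fderiv ℝ B p q v w := by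
  rw [((hB.hasFDerivAt.clm_apply (hasFDerivAt_const v p)).clm_apply (hasFDerivAt_const w p)).fderiv]
  simp

theorem IsSymmetricOn.fderiv_symm (hC : IsSymmetricOn C s) {x : E} (hx : x ∈ s) (u v w : E) :
    fderiv ℝ C x u v w = fderiv ℝ C x u w v := by
  have hd := (hC.contDiffAt hx).differentiableAt (by simp)
  rw [← fderiv_clm_apply₂ hd, ← fderiv_clm_apply₂ hd]
  have h : (fun p ↦ C p v w) =ᶠ[𝓝 x] fun p ↦ C p w v := by
    filter_upwards [hC.isOpen.mem_nhds hx] with y hy using hC.symm y hy v w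
  rw [h.fderiv_eq]

theorem isLinearMap_christoffel (G : E → E →L[ℝ] E →L[ℝ] ℝ) (u v w : E) : IsLinearMap ℝ fun b ↦
    (1 / 2 : ℝ) * (fderiv ℝ G u v w b + fderiv ℝ G u w v b - fderiv ℝ G u b v w) := by
  constructor
  · intro x y; simp; ring
  · intro c x; simp; ring

theorem IsMetricOn.christoffel_symm (hG : IsMetricOn G s) {x : E} (hx : x ∈ s) (v w : E) :
    christoffel G x v w = christoffel G x w v := by
  unfold christoffel
  congr 1
  funext b
  rw [hG.fderiv_symm hx b v w]
  ring

theorem IsSymmetricOn.contDiffAt_apply (hC : IsSymmetricOn C s) {p : E × E × E} (hp : p.1 ∈ s) :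
    ContDiffAt ℝ ∞ (fun p : E × E × E ↦ C p.1 p.2.1 p.2.2) p :=
  ContDiffAt.clm_apply (ContDiffAt.clm_apply
    (ContDiffAt.comp (g := C) p (hC.contDiffAt hp) contDiffAt_fst) (by fun_prop)) (by fun_prop)

set_option maxSynthPendingDepth 3 in
theorem IsSymmetricOn.contDiffAt_fderiv_apply (hC : IsSymmetricOn C s) {P : Type*}
    [NormedAddCommGroup P] [NormedSpace ℝ P] {p : P} {α β γ δ : P → E} (hp : α p ∈ s)
    (hα : ContDiffAt ℝ ∞ α p) (hβ : ContDiffAt ℝ ∞ β p) (hγ : ContDiffAt ℝ ∞ γ p)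
    (hδ : ContDiffAt ℝ ∞ δ p) :
    ContDiffAt ℝ ∞ (fun p ↦ fderiv ℝ C (α p) (β p) (γ p) (δ p)) p :=
  ((ContDiffAt.clm_apply (ContDiffAt.comp (g := fderiv ℝ C) p
    ((hC.contDiffAt hp).fderiv_right (by simp)) hα) hβ).clm_apply hγ).clm_apply hδ

theorem isLinearMap_deformation (C : E → E →L[ℝ] E →L[ℝ] ℝ) (u v w a : E) : IsLinearMap ℝ fun b ↦
    (1 / 2 : ℝ) * (fderiv ℝ C u v w b + fderiv ℝ C u w v b - fderiv ℝ C u b v w) - C u a b := by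
  constructor
  · intro x y; simp; ring
  · intro c x; simp; ring

/-- Of the six Christoffel terms four cancel by the symmetry of `Γ` and `C`, and the other two both
equal `-C(Γ(v, w), b)`. The remainder has the form in which `H` appears in the Koszul formula of the
deformed metric. -/
theorem deformationTensor_eq (hG : IsMetricOn G s) (hC : IsSymmetricOn C s) {x : E} (hx : x ∈ s)
    (v w : E) : deformationTensor G C x v w = sharp (G x) fun b ↦
      (1 / 2 : ℝ) * (fderiv ℝ C x v w b + fderiv ℝ C x w v b - fderiv ℝ C x b v w)
        - C x (christoffel G x v w) b := by
  unfold deformationTensor covDerivForm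
  congr 1
  funext b
  rw [hG.christoffel_symm hx w v, hG.christoffel_symm hx b v, hG.christoffel_symm hx b w,
    hC.symm x hx w (christoffel G x v b)]
  ring

variable [FiniteDimensional ℝ E]

theorem IsMetricOn.christoffel_spec (hG : IsMetricOn G s) {x : E} (hx : x ∈ s) (v w b : E) :
    G x (christoffel G x v w) b =
      (1 / 2 : ℝ) * (fderiv ℝ G x v w b + fderiv ℝ G x w v b - fderiv ℝ G x b v w) :=
  sharp_spec (hG.nondegenerate x hx) (isLinearMap_christoffel G x v w) b

/-- With its right-hand companion, this is what lets multiplication by the curve parameter pass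
through the lifted Christoffel symbols. -/
theorem IsMetricOn.christoffel_smul_left (hG : IsMetricOn G s) {x : E} (hx : x ∈ s) (t : ℝ)
    (v w : E) : christoffel G x (t • v) w = t • christoffel G x v w :=
  sharp_smul (hG.nondegenerate x hx) (isLinearMap_christoffel G x v w) fun b ↦ by simp; ring

theorem IsMetricOn.christoffel_smul_right (hG : IsMetricOn G s) {x : E} (hx : x ∈ s) (t : ℝ)
    (v w : E) : christoffel G x v (t • w) = t • christoffel G x v w :=
  sharp_smul (hG.nondegenerate x hx) (isLinearMap_christoffel G x v w) fun b ↦ by simp; ring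

theorem IsMetricOn.contDiffAt_christoffel (hG : IsMetricOn G s) {p : E × E × E} (hp : p.1 ∈ s) :
    ContDiffAt ℝ ∞ (fun p : E × E × E ↦ christoffel G p.1 p.2.1 p.2.2) p := by
  refine contDiffAt_sharp (ContDiffAt.comp (g := G) p (hG.contDiffAt hp) contDiffAt_fst) ?_
    (Filter.Eventually.of_forall fun q ↦ isLinearMap_christoffel _ _ _ _) fun b ↦ ?_
  · filter_upwards [(hG.isOpen.preimage continuous_fst).mem_nhds hp] with q hq
    exact hG.nondegenerate _ hq
  · exact contDiffAt_const.mul (((hG.contDiffAt_fderiv_apply hp (by fun_prop) (by fun_prop)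
      (by fun_prop) (by fun_prop)).add (hG.contDiffAt_fderiv_apply hp (by fun_prop) (by fun_prop)
      (by fun_prop) (by fun_prop))).sub (hG.contDiffAt_fderiv_apply hp (by fun_prop) (by fun_prop)
      (by fun_prop) (by fun_prop)))

theorem deformationTensor_spec (hG : IsMetricOn G s) (hC : IsSymmetricOn C s) {x : E} (hx : x ∈ s)
    (v w b : E) : G x (deformationTensor G C x v w) b =
      (1 / 2 : ℝ) * (fderiv ℝ C x v w b + fderiv ℝ C x w v b - fderiv ℝ C x b v w)
        - C x (christoffel G x v w) b := by
  rw [deformationTensor_eq hG hC hx]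
  exact sharp_spec (hG.nondegenerate x hx) (isLinearMap_deformation C x v w _) b

/-- A shifted jet has base component `0`, so this removes the `H` term from the Christoffel symbols
there. -/
theorem deformationTensor_zero_left (hG : IsMetricOn G s) (hC : IsSymmetricOn C s) {x : E}
    (hx : x ∈ s) (w : E) : deformationTensor G C x 0 w = 0 := by
  have h := hG.christoffel_smul_left hx 0 0 w
  rw [zero_smul, zero_smul] at h
  rw [deformationTensor_eq hG hC hx, h]
  exact sharp_eq (hG.nondegenerate x hx) (by simp)

theorem deformationTensor_zero_right (hG : IsMetricOn G s) (hC : IsSymmetricOn C s) {x : E}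
    (hx : x ∈ s) (v : E) : deformationTensor G C x v 0 = 0 := by
  have h := hG.christoffel_smul_right hx 0 v 0
  rw [zero_smul, zero_smul] at h
  rw [deformationTensor_eq hG hC hx, h]
  exact sharp_eq (hG.nondegenerate x hx) (by simp)

theorem contDiffAt_deformationTensor (hG : IsMetricOn G s) (hC : IsSymmetricOn C s) {x : E}
    (hx : x ∈ s) (v w : E) : ContDiffAt ℝ ∞ (fun x ↦ deformationTensor G C x v w) x := by
  have h : ∀ᶠ y in 𝓝 x, y ∈ s := hG.isOpen.mem_nhds hx
  have hΓ : ContDiffAt ℝ ∞ (fun x ↦ christoffel G x v w) x :=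
    ContDiffAt.comp (f := fun x : E ↦ (x, v, w)) x
      (hG.contDiffAt_christoffel (p := (x, v, w)) hx) (by fun_prop)
  refine ContDiffAt.congr_of_eventuallyEq ?_ (h.mono fun y hy ↦ deformationTensor_eq hG hC hy v w)
  refine contDiffAt_sharp (hG.contDiffAt hx) (h.mono hG.nondegenerate)
    (Filter.Eventually.of_forall fun q ↦ isLinearMap_deformation _ _ _ _ _) fun b ↦ ?_
  refine ContDiffAt.sub ?_ (((hC.contDiffAt hx).clm_apply hΓ).clm_apply contDiffAt_const)
  exact contDiffAt_const.mul (((hC.contDiffAt_fderiv_apply hx (by fun_prop) (by fun_prop)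
      (by fun_prop) (by fun_prop)).add (hC.contDiffAt_fderiv_apply hx (by fun_prop) (by fun_prop)
      (by fun_prop) (by fun_prop))).sub (hC.contDiffAt_fderiv_apply hx (by fun_prop) (by fun_prop)
      (by fun_prop) (by fun_prop)))

end LocalGeometry


/-! ### The deformed metric in coordinates and its Christoffel symbols. -/

section LiftedMetric

variable {E : Type*} [NormedAddCommGroup E] [NormedSpace ℝ E]
variable {G C : E → E →L[ℝ] E →L[ℝ] ℝ} {V : E → E} {s : Set E}

/-- Components of the deformed 2-nd lift metric. -/
def deformedComp (G C : E → E →L[ℝ] E →L[ℝ] ℝ) (u : E × E × E) :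
    (E × E × E) →L[ℝ] (E × E × E) →L[ℝ] ℝ :=
  lift2FormComp G u + lift0FormComp C u

/-- The block matrix is the `t²`-coefficient of the product of the jets of `G`, `a` and `b`. -/
theorem lift2FormComp_eq_prolong (hG : IsSymmetricOn G s) {u : E × E × E} (hu : u.1 ∈ s)
    (a b : E × E × E) : lift2FormComp G u a b =
      (prolong (fun p : E × E × E ↦ G p.1 p.2.1 p.2.2) (jetPair u (jetPair a b))).2.2 := by
  have h0 : ContDiffAt ℝ ∞ (fun p : E × E × E ↦ G p.1) (jetPair u (jetPair a b)).1 :=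
    ContDiffAt.comp (g := G) _ (hG.contDiffAt hu) contDiffAt_fst
  have h1 : prolong (fun p : E × E × E ↦ G p.1) (jetPair u (jetPair a b)) = prolong G u := by
    rw [prolong_comp (f := G) (g := Prod.fst) contDiffAt_fst (hG.contDiffAt hu), prolong_fst]
  have ha : prolong (fun p : E × E × E ↦ p.2.1) (jetPair u (jetPair a b)) = a :=
    prolong_clm ((ContinuousLinearMap.fst ℝ E E).comp (ContinuousLinearMap.snd ℝ E (E × E))) _
  have hb : prolong (fun p : E × E × E ↦ p.2.2) (jetPair u (jetPair a b)) = b :=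
    prolong_clm ((ContinuousLinearMap.snd ℝ E E).comp (ContinuousLinearMap.snd ℝ E (E × E))) _
  rw [prolong_clm_apply (h0.clm_apply (by fun_prop)) (by fun_prop),
    prolong_clm_apply h0 (by fun_prop), h1, ha, hb]
  simp [lift2FormComp, prolong]
  ring

theorem lift2FormComp_eq_curveJet (hG : IsSymmetricOn G s) {u : E × E × E} (hu : u.1 ∈ s)
    {a b : E × E × E} {α : ℝ → E} (hα : ContDiffAt ℝ ∞ α 0) (ha : curveJet α = a) :
    lift2FormComp G u a b = (curveJet fun t ↦ G (jetCurve u t) (α t) (jetCurve b t)).2.2 := by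
  rw [lift2FormComp_eq_prolong hG hu, prolong_jetPair₃ (hG.contDiffAt_apply hu)
    (contDiffAt_jetCurve u) hα (contDiffAt_jetCurve b) (curveJet_jetCurve u) ha (curveJet_jetCurve b)]

theorem lift0FormComp_apply (u a b : E × E × E) : lift0FormComp C u a b = C u.1 a.1 b.1 := rfl

theorem deformedComp_apply (u a b : E × E × E) :
    deformedComp G C u a b = lift2FormComp G u a b + C u.1 a.1 b.1 := rfl

theorem lift2FormComp_vertical (u b : E × E × E) (h : E) :
    lift2FormComp G u (0, 0, h) b = G u.1 h b.1 := by
  simp [lift2FormComp]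

/-- The matrix is block triangular with respect to the antidiagonal, on which every block is `G`;
testing against the last, middle and first slots kills the components of `a` in order. -/
theorem deformedComp_nondegenerate (hG : IsMetricOn G s) {u : E × E × E} (hu : u.1 ∈ s)
    (a : E × E × E) (h : ∀ b, deformedComp G C u a b = 0) : a = 0 := by
  have h0 : a.1 = 0 := hG.nondegenerate _ hu _ fun w ↦ by
    simpa [deformedComp, lift2FormComp, lift0FormComp] using h (0, 0, w)
  have h1 : a.2.1 = 0 := hG.nondegenerate _ hu _ fun w ↦ by
    simpa [deformedComp, lift2FormComp, lift0FormComp, h0] using h (0, w, 0)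
  have h2 : a.2.2 = 0 := hG.nondegenerate _ hu _ fun w ↦ by
    simpa [deformedComp, lift2FormComp, lift0FormComp, h0, h1] using h (w, 0, 0)
  exact Prod.ext h0 (Prod.ext h1 h2)

theorem contDiffAt_deformedComp_apply (hG : IsSymmetricOn G s) (hC : IsSymmetricOn C s)
    {u : E × E × E} (hu : u.1 ∈ s) (a b : E × E × E) :
    ContDiffAt ℝ ∞ (fun u ↦ deformedComp G C u a b) u := by
  have h1 : ContDiffAt ℝ ∞ (fun u : E × E × E ↦
      (prolong (fun p : E × E × E ↦ G p.1 p.2.1 p.2.2) (jetPair u (jetPair a b))).2.2) u := by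
    have := ContDiffAt.comp (g := prolong fun p : E × E × E ↦ G p.1 p.2.1 p.2.2)
      (f := fun u : E × E × E ↦ jetPair u (jetPair a b)) u
      (contDiffAt_prolong (hG.contDiffAt_apply (p := (u.1, a.1, b.1)) hu))
      (by unfold jetPair; fun_prop)
    exact this.snd.snd
  have h2 : ContDiffAt ℝ ∞ (fun u : E × E × E ↦ C u.1 a.1 b.1) u :=
    ((ContDiffAt.comp (g := C) u (hC.contDiffAt hu) contDiffAt_fst).clm_apply
      contDiffAt_const).clm_apply contDiffAt_const
  refine (h1.add h2).congr_of_eventuallyEq ?_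
  filter_upwards [(hG.isOpen.preimage continuous_fst).mem_nhds hu] with u' hu'
  rw [deformedComp_apply, lift2FormComp_eq_prolong hG hu']

variable [FiniteDimensional ℝ E]

theorem contDiffAt_deformedComp (hG : IsSymmetricOn G s) (hC : IsSymmetricOn C s)
    {u : E × E × E} (hu : u.1 ∈ s) : ContDiffAt ℝ ∞ (deformedComp G C) u := by
  have ho : IsOpen (Prod.fst ⁻¹' s : Set (E × E × E)) := hG.isOpen.preimage continuous_fst
  refine ContDiffOn.contDiffAt (s := Prod.fst ⁻¹' s) ?_ (ho.mem_nhds hu)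
  refine contDiffOn_clm_apply.2 fun a ↦ contDiffOn_clm_apply.2 fun b ↦ fun u' hu' ↦ ?_
  exact (contDiffAt_deformedComp_apply hG hC hu' a b).contDiffWithinAt

/-- Each term of the Koszul formula of the deformed metric becomes the `t²`-coefficient of the
corresponding term for `G` along curves, plus a term in `C` at the base point. -/
theorem fderiv_deformedComp (hG : IsSymmetricOn G s) (hC : IsSymmetricOn C s)
    {u : E × E × E} (hu : u.1 ∈ s) (v w b : E × E × E) :
    fderiv ℝ (deformedComp G C) u v w b =
      (curveJet fun t ↦ fderiv ℝ G (jetCurve u t) (jetCurve v t) (jetCurve w t)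
        (jetCurve b t)).2.2 + fderiv ℝ C u.1 v.1 w.1 b.1 := by
  rw [← fderiv_clm_apply₂ ((contDiffAt_deformedComp hG hC hu).differentiableAt (by simp))]
  have h1 : ContDiffAt ℝ ∞ (fun u : E × E × E ↦
      prolong (fun p : E × E × E ↦ G p.1 p.2.1 p.2.2) (jetPair u (jetPair w b))) u :=
    ContDiffAt.comp (g := prolong fun p : E × E × E ↦ G p.1 p.2.1 p.2.2)
      (f := fun u : E × E × E ↦ jetPair u (jetPair w b)) u
      (contDiffAt_prolong (hG.contDiffAt_apply (p := (u.1, w.1, b.1)) hu))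
      (by unfold jetPair; fun_prop)
  have h2 : (fun u ↦ deformedComp G C u w b) =ᶠ[𝓝 u] fun u ↦
      (prolong (fun p : E × E × E ↦ G p.1 p.2.1 p.2.2) (jetPair u (jetPair w b))).2.2
        + C u.1 w.1 b.1 := by
    filter_upwards [(hG.isOpen.preimage continuous_fst).mem_nhds hu] with u' hu'
    rw [deformedComp_apply, lift2FormComp_eq_prolong hG hu']
  have hCd := ((hC.contDiffAt hu).differentiableAt (by simp)).hasFDerivAt
  have h3 : HasFDerivAt (fun u : E × E × E ↦ C u.1 w.1 b.1) _ u :=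
    (((hCd.comp u hasFDerivAt_fst).clm_apply (hasFDerivAt_const w.1 u)).clm_apply
      (hasFDerivAt_const b.1 u))
  rw [h2.fderiv_eq, (((h1.differentiableAt (by simp)).hasFDerivAt.snd.snd).fun_add h3).fderiv]
  have h4 := fderiv_prolong_left_eq_curveJet hG.isOpen
    (f := fun p : E × E × E ↦ G p.1 p.2.1 p.2.2) (fun p hp ↦ hG.contDiffAt_apply hp) hu
    (jetPair w b) (contDiffAt_jetCurve v) (curveJet_jetCurve v)
  have h5 : (fderiv ℝ (fun u : E × E × E ↦ prolong (fun p : E × E × E ↦ G p.1 p.2.1 p.2.2)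
      (jetPair u (jetPair w b))) u v).2.2 = (curveJet fun t ↦ fderiv ℝ G (jetCurve u t)
        (jetCurve v t) (jetCurve w t) (jetCurve b t)).2.2 := by
    rw [h4]
    refine congrArg (fun q : ℝ × ℝ × ℝ ↦ q.2.2) (curveJet_congr ?_)
    filter_upwards [eventually_jetCurve_mem hG.isOpen hu] with t ht
    exact fderiv_clm_apply₂ ((hG.contDiffAt ht).differentiableAt (by simp)) _ _ _
  rw [← h5]
  simp

/-- The Christoffel symbols of the deformed 2-nd lift metric. -/
theorem christoffel_deformedComp (hG : IsMetricOn G s) (hC : IsSymmetricOn C s)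
    {u : E × E × E} (hu : u.1 ∈ s) (v w : E × E × E) :
    christoffel (deformedComp G C) u v w =
      prolong (fun p : E × E × E ↦ christoffel G p.1 p.2.1 p.2.2) (jetPair u (jetPair v w))
        + (0, 0, deformationTensor G C u.1 v.1 w.1) := by
  refine sharp_eq (deformedComp_nondegenerate hG hu) fun b ↦ ?_
  have hΓ : ContDiffAt ℝ ∞ (fun t ↦ christoffel G (jetCurve u t) (jetCurve v t) (jetCurve w t)) 0 :=
    ContDiffAt.comp (f := fun t ↦ (jetCurve u t, jetCurve v t, jetCurve w t))
      (g := fun p : E × E × E ↦ christoffel G p.1 p.2.1 p.2.2) 0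
      (hG.contDiffAt_christoffel (by simpa [jetCurve_zero] using hu))
      ((contDiffAt_jetCurve u).prodMk ((contDiffAt_jetCurve v).prodMk (contDiffAt_jetCurve w)))
  have h1 := prolong_jetPair₃ (f := fun p : E × E × E ↦ christoffel G p.1 p.2.1 p.2.2)
    (hG.contDiffAt_christoffel hu) (contDiffAt_jetCurve u) (contDiffAt_jetCurve v)
    (contDiffAt_jetCurve w) (curveJet_jetCurve u) (curveJet_jetCurve v) (curveJet_jetCurve w)
  have hD : ∀ a₁ a₂ a₃ : E × E × E, ContDiffAt ℝ ∞ (fun t ↦ fderiv ℝ G (jetCurve u t)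
      (jetCurve a₁ t) (jetCurve a₂ t) (jetCurve a₃ t)) 0 := fun a₁ a₂ a₃ ↦
    hG.contDiffAt_fderiv_apply (by simpa [jetCurve_zero] using hu) (contDiffAt_jetCurve u)
      (contDiffAt_jetCurve a₁) (contDiffAt_jetCurve a₂) (contDiffAt_jetCurve a₃)
  have hGΓ : ContDiffAt ℝ ∞ (fun t ↦ G (jetCurve u t) (christoffel G (jetCurve u t) (jetCurve v t)
      (jetCurve w t)) (jetCurve b t)) 0 :=
    ((ContDiffAt.comp (g := G) 0 (hG.contDiffAt (by simpa [jetCurve_zero] using hu))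
      (contDiffAt_jetCurve u)).clm_apply hΓ).clm_apply (contDiffAt_jetCurve b)
  rw [map_add, add_apply, deformedComp_apply, deformedComp_apply,
    lift2FormComp_vertical, h1,
    lift2FormComp_eq_curveJet hG.toIsSymmetricOn hu hΓ rfl, deformationTensor_spec hG hC hu,
    fderiv_deformedComp hG.toIsSymmetricOn hC hu, fderiv_deformedComp hG.toIsSymmetricOn hC hu,
    fderiv_deformedComp hG.toIsSymmetricOn hC hu]
  -- The Koszul identity of `G` along the curves, as an identity of jets; the left side is a sum of
  -- two copies so that no factor `½` has to pass through `curveJet`.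
  have h2 : curveJet (fun t ↦ G (jetCurve u t) (christoffel G (jetCurve u t) (jetCurve v t)
        (jetCurve w t)) (jetCurve b t)) + curveJet (fun t ↦ G (jetCurve u t)
        (christoffel G (jetCurve u t) (jetCurve v t) (jetCurve w t)) (jetCurve b t)) =
      curveJet (fun t ↦ fderiv ℝ G (jetCurve u t) (jetCurve v t) (jetCurve w t) (jetCurve b t)) +
      curveJet (fun t ↦ fderiv ℝ G (jetCurve u t) (jetCurve w t) (jetCurve v t) (jetCurve b t)) -
      curveJet (fun t ↦ fderiv ℝ G (jetCurve u t) (jetCurve b t) (jetCurve v t) (jetCurve w t)) := by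
    rw [← curveJet_add hGΓ hGΓ, ← curveJet_add (hD v w b) (hD w v b),
      ← curveJet_sub ((hD v w b).add (hD w v b)) (hD b v w)]
    refine curveJet_congr ?_
    filter_upwards [eventually_jetCurve_mem hG.isOpen hu] with t ht
    rw [hG.christoffel_spec ht]
    ring
  have h3 := congrArg (fun q : ℝ × ℝ × ℝ ↦ q.2.2) h2
  simp only [Prod.snd_add, Prod.snd_sub] at h3
  -- The lift of `C` sees only the base of the Christoffel jet. Its contribution `C(Γ(v, w), b)`
  -- cancels the term `-C(Γ(v, w), b)` in `deformationTensor_spec`.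
  have h4 : (curveJet fun t ↦ christoffel G (jetCurve u t) (jetCurve v t) (jetCurve w t)).1 =
      christoffel G u.1 v.1 w.1 := by
    simp [curveJet, jetCurve_zero]
  rw [h4]
  simp only [map_zero, zero_apply]
  linarith

end LiftedMetric


/-! ### The Lie derivative of the lifted connection along the three lifts. -/

section LieDerivative

variable {E : Type*} [NormedAddCommGroup E] [NormedSpace ℝ E]
variable {G C : E → E →L[ℝ] E →L[ℝ] ℝ} {V : E → E} {s : Set E}

theorem curveJet_lieDerivConnection_eq_zero (hs : IsOpen s) {u : E × E × E} (hu : u.1 ∈ s)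
    (h : ∀ x ∈ s, ∀ v w, lieDerivConnection G V x v w = 0) (v w : E × E × E) :
    (curveJet fun t ↦ lieDerivConnection G V (jetCurve u t) (jetCurve v t) (jetCurve w t)) = 0 := by
  rw [curveJet_congr (δ := fun _ ↦ 0)]
  · simp [curveJet]
  · filter_upwards [eventually_jetCurve_mem hs hu] with t ht using h _ ht _ _

variable [FiniteDimensional ℝ E]

theorem IsMetricOn.contDiffAt_christoffel_comp (hG : IsMetricOn G s) {P : Type*}
    [NormedAddCommGroup P] [NormedSpace ℝ P] {p : P} {α β γ : P → E} (hp : α p ∈ s)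
    (hα : ContDiffAt ℝ ∞ α p) (hβ : ContDiffAt ℝ ∞ β p) (hγ : ContDiffAt ℝ ∞ γ p) :
    ContDiffAt ℝ ∞ (fun p ↦ christoffel G (α p) (β p) (γ p)) p :=
  ContDiffAt.comp (f := fun t ↦ (α t, β t, γ t))
    (g := fun p : E × E × E ↦ christoffel G p.1 p.2.1 p.2.2) p
    (hG.contDiffAt_christoffel hp) (hα.prodMk (hβ.prodMk hγ))

theorem christoffel_deformedComp_eq_curveJet (hG : IsMetricOn G s) (hC : IsSymmetricOn C s)
    {u : E × E × E} (hu : u.1 ∈ s) {v w : E × E × E} {β γ : ℝ → E} (hβ : ContDiffAt ℝ ∞ β 0)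
    (hγ : ContDiffAt ℝ ∞ γ 0) (hv : curveJet β = v) (hw : curveJet γ = w) :
    christoffel (deformedComp G C) u v w =
      (curveJet fun t ↦ christoffel G (jetCurve u t) (β t) (γ t))
        + (0, 0, deformationTensor G C u.1 v.1 w.1) := by
  rw [christoffel_deformedComp hG hC hu, prolong_jetPair₃ (hG.contDiffAt_christoffel hu)
    (contDiffAt_jetCurve u) hβ hγ (curveJet_jetCurve u) hv hw]

/-- The direction `a` is represented by an arbitrary curve, so that both `V (jetCurve u t)` and `t •
jetCurve a t` can be inserted. -/
theorem fderiv_christoffel_deformedComp (hG : IsMetricOn G s) (hC : IsSymmetricOn C s)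
    {u : E × E × E} (hu : u.1 ∈ s) (v w : E × E × E) {a : E × E × E} {α : ℝ → E}
    (hα : ContDiffAt ℝ ∞ α 0) (ha : curveJet α = a) :
    fderiv ℝ (fun u ↦ christoffel (deformedComp G C) u v w) u a =
      (curveJet fun t ↦ fderiv ℝ (fun x ↦ christoffel G x (jetCurve v t) (jetCurve w t))
        (jetCurve u t) (α t))
        + (0, 0, fderiv ℝ (fun x ↦ deformationTensor G C x v.1 w.1) u.1 a.1) := by
  have h1 : (fun u ↦ christoffel (deformedComp G C) u v w) =ᶠ[𝓝 u] fun u ↦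
      prolong (fun p : E × E × E ↦ christoffel G p.1 p.2.1 p.2.2) (jetPair u (jetPair v w))
        + (0, 0, deformationTensor G C u.1 v.1 w.1) := by
    filter_upwards [(hG.isOpen.preimage continuous_fst).mem_nhds hu] with u' hu'
    exact christoffel_deformedComp hG hC hu' v w
  have h2 : ContDiffAt ℝ ∞ (fun u ↦ prolong (fun p : E × E × E ↦ christoffel G p.1 p.2.1 p.2.2)
      (jetPair u (jetPair v w))) u :=
    ContDiffAt.comp (g := prolong fun p : E × E × E ↦ christoffel G p.1 p.2.1 p.2.2)
      (f := fun u : E × E × E ↦ jetPair u (jetPair v w)) u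
      (contDiffAt_prolong (hG.contDiffAt_christoffel (p := (u.1, v.1, w.1)) hu))
      (by unfold jetPair; fun_prop)
  have h3 := ((contDiffAt_deformationTensor hG hC hu v.1 w.1).differentiableAt
    (by simp)).hasFDerivAt
  have h4 : HasFDerivAt (fun u : E × E × E ↦ deformationTensor G C u.1 v.1 w.1) _ u :=
    h3.comp u hasFDerivAt_fst
  have h5 := (h2.differentiableAt (by simp)).hasFDerivAt.fun_add
    ((hasFDerivAt_const (0 : E) u).prodMk ((hasFDerivAt_const (0 : E) u).prodMk h4))
  rw [h1.fderiv_eq, h5.fderiv, add_apply, fderiv_prolong_left_eq_curveJet hG.isOpen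
    (f := fun p : E × E × E ↦ christoffel G p.1 p.2.1 p.2.2)
    (fun p hp ↦ hG.contDiffAt_christoffel hp) hu (jetPair v w) hα ha]
  rfl

/-- The partial derivative is the total derivative in the direction `(α, 0, 0)`. Its smoothness
along the curve is needed for the additivity of `curveJet`. -/
theorem contDiffAt_curve_fderiv_christoffel (hG : IsMetricOn G s)
    {u : E × E × E} (hu : u.1 ∈ s) (v w : E × E × E) {α : ℝ → E}
    (hα : ContDiffAt ℝ ∞ α 0) :
    ContDiffAt ℝ ∞ (fun t ↦ fderiv ℝ (fun x ↦ christoffel G x (jetCurve v t) (jetCurve w t))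
        (jetCurve u t) (α t)) 0 := by
  have hu0 : jetCurve u 0 ∈ s := by rwa [jetCurve_zero]
  have h := ContDiffAt.comp (f := fun t ↦ ((jetCurve u t, jetCurve v t, jetCurve w t),
      (α t, (0 : E × E))))
    (g := fun q : (E × E × E) × (E × E × E) ↦
      fderiv ℝ (fun p : E × E × E ↦ christoffel G p.1 p.2.1 p.2.2) q.1 q.2) 0
    (contDiffAt_fderiv_apply (hG.contDiffAt_christoffel hu0))
    (((contDiffAt_jetCurve u).prodMk ((contDiffAt_jetCurve v).prodMk
      (contDiffAt_jetCurve w))).prodMk (hα.prodMk contDiffAt_const))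
  refine h.congr_of_eventuallyEq ?_
  filter_upwards [eventually_jetCurve_mem hG.isOpen hu] with t ht
  have h1 := ((hG.contDiffAt_christoffel (p := (jetCurve u t, jetCurve v t, jetCurve w t))
    ht).differentiableAt (by simp)).hasFDerivAt
  have h2 : HasFDerivAt (fun x : E ↦ christoffel G x (jetCurve v t) (jetCurve w t)) _
      (jetCurve u t) :=
    h1.comp (f := fun x : E ↦ (x, jetCurve v t, jetCurve w t)) (jetCurve u t)
      ((hasFDerivAt_id _).prodMk (hasFDerivAt_const _ _))
  rw [h2.fderiv]
  simp

/-- The Lie derivative of the Levi-Civita connection of the deformed 2-nd lift metric along the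
2-nd lift of a vector field. -/
theorem lieDerivConnection_prolong (hG : IsMetricOn G s) (hC : IsSymmetricOn C s)
    (hV : ContDiffOn ℝ ∞ V s) {u : E × E × E} (hu : u.1 ∈ s) (v w : E × E × E) :
    lieDerivConnection (deformedComp G C) (prolong V) u v w =
      (curveJet fun t ↦ lieDerivConnection G V (jetCurve u t) (jetCurve v t) (jetCurve w t))
        + (0, 0, lieDerivTensor V (deformationTensor G C) u.1 v.1 w.1) := by
  have hV' : ∀ x ∈ s, ContDiffAt ℝ ∞ V x := fun x hx ↦ hV.contDiffAt (hG.isOpen.mem_nhds hx)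
  have hu0 : jetCurve u 0 ∈ s := by rwa [jetCurve_zero]
  have cu := contDiffAt_jetCurve u
  have cv := contDiffAt_jetCurve v
  have cw := contDiffAt_jetCurve w
  have cV : ContDiffAt ℝ ∞ (fun t ↦ V (jetCurve u t)) 0 :=
    ContDiffAt.comp (g := V) 0 (hV' _ hu0) cu
  have cDV : ∀ {α : ℝ → E}, ContDiffAt ℝ ∞ α 0 →
      ContDiffAt ℝ ∞ (fun t ↦ fderiv ℝ V (jetCurve u t) (α t)) 0 := fun hα ↦
    ContDiffAt.clm_apply (ContDiffAt.comp (g := fderiv ℝ V) 0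
      ((hV' _ hu0).fderiv_right (by simp)) cu) hα
  have cDDV : ContDiffAt ℝ ∞ (fun t ↦ fderiv ℝ (fderiv ℝ V) (jetCurve u t) (jetCurve v t)
      (jetCurve w t)) 0 :=
    (ContDiffAt.clm_apply (ContDiffAt.comp (g := fderiv ℝ (fderiv ℝ V)) 0
      (((hV' _ hu0).fderiv_right (m := ∞) (by simp)).fderiv_right (by simp)) cu) cv).clm_apply cw
  have cΓ : ∀ {β γ : ℝ → E}, ContDiffAt ℝ ∞ β 0 → ContDiffAt ℝ ∞ γ 0 →
      ContDiffAt ℝ ∞ (fun t ↦ christoffel G (jetCurve u t) (β t) (γ t)) 0 := fun hβ hγ ↦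
    hG.contDiffAt_christoffel_comp hu0 cu hβ hγ
  have hDV : ∀ {α : ℝ → E} {a : E × E × E}, ContDiffAt ℝ ∞ α 0 → curveJet α = a →
      fderiv ℝ (prolong V) u a = curveJet fun t ↦ fderiv ℝ V (jetCurve u t) (α t) := by
    intro α a hα ha
    rw [fderiv_prolong (hV' _ hu), prolong_jetPair (f := fun p : E × E ↦ fderiv ℝ V p.1 p.2)
      (contDiffAt_fderiv_apply (hV' _ hu)) cu hα (curveJet_jetCurve u) ha]
  -- `t1` to `t5` write the five terms of the Lie derivative as a jet along curves, with a vertical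
  -- correction by `H` in all but the first.
  have t1 := fderiv_fderiv_prolong hG.isOpen hV hu v w
  have t2 := fderiv_christoffel_deformedComp hG hC hu v w cV
    (prolong_eq_curveJet (hV' _ hu)).symm
  have t3 : fderiv ℝ (prolong V) u (christoffel (deformedComp G C) u v w) =
      (curveJet fun t ↦ fderiv ℝ V (jetCurve u t)
        (christoffel G (jetCurve u t) (jetCurve v t) (jetCurve w t)))
        + (0, 0, fderiv ℝ V u.1 (deformationTensor G C u.1 v.1 w.1)) := by
    rw [christoffel_deformedComp_eq_curveJet hG hC hu cv cw (curveJet_jetCurve v)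
      (curveJet_jetCurve w), map_add, fderiv_prolong_vertical (hV' _ hu), hDV (cΓ cv cw) rfl]
  have t4 := christoffel_deformedComp_eq_curveJet hG hC hu (cDV cv) cw
    (hDV cv (curveJet_jetCurve v)).symm (curveJet_jetCurve w)
  have t5 := christoffel_deformedComp_eq_curveJet hG hC hu cv (cDV cw)
    (curveJet_jetCurve v) (hDV cw (curveJet_jetCurve w)).symm
  rw [fderiv_prolong_fst (hV' _ hu)] at t4 t5
  have cT := contDiffAt_curve_fderiv_christoffel hG hu v w cV
  unfold lieDerivConnection lieDerivTensor
  rw [t1, t2, t3, t4, t5]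
  rw [curveJet_add cDDV (((cT.sub (cDV (cΓ cv cw))).add (cΓ (cDV cv) cw)).add (cΓ cv (cDV cw))),
    curveJet_add ((cT.sub (cDV (cΓ cv cw))).add (cΓ (cDV cv) cw)) (cΓ cv (cDV cw)),
    curveJet_add (cT.sub (cDV (cΓ cv cw))) (cΓ (cDV cv) cw),
    curveJet_sub cT (cDV (cΓ cv cw))]
  have h0 : ∀ a b c d : E, ((0, 0, a - b + c + d) : E × E × E) =
      (0, 0, a) - (0, 0, b) + (0, 0, c) + (0, 0, d) := by
    intro a b c d; simp
  rw [h0]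
  have h1 : (prolong V u).1 = V u.1 := rfl
  rw [h1]
  abel

/-- The `H` terms vanish on both sides: on the left because the shifted jet has base `0`, on the
right because `t · t² = 0`. -/
theorem christoffel_deformedComp_shift_left (hG : IsMetricOn G s) (hC : IsSymmetricOn C s)
    {u : E × E × E} (hu : u.1 ∈ s) (v w : E × E × E) :
    christoffel (deformedComp G C) u (jetShift v) w =
      jetShift (christoffel (deformedComp G C) u v w) := by
  have hu0 : jetCurve u 0 ∈ s := by rwa [jetCurve_zero]
  rw [christoffel_deformedComp_eq_curveJet hG hC hu (contDiffAt_smul_jetCurve v)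
    (contDiffAt_jetCurve w) (curveJet_smul_jetCurve v) (curveJet_jetCurve w),
    christoffel_deformedComp_eq_curveJet hG hC hu (contDiffAt_jetCurve v)
    (contDiffAt_jetCurve w) (curveJet_jetCurve v) (curveJet_jetCurve w), map_add,
    ← curveJet_smul (hG.contDiffAt_christoffel_comp hu0 (contDiffAt_jetCurve u)
      (contDiffAt_jetCurve v) (contDiffAt_jetCurve w))]
  congr 1
  · refine curveJet_congr ?_
    filter_upwards [eventually_jetCurve_mem hG.isOpen hu] with t ht
    exact hG.christoffel_smul_left ht _ _ _
  · simp [deformationTensor_zero_left hG hC hu]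

theorem christoffel_deformedComp_shift_right (hG : IsMetricOn G s) (hC : IsSymmetricOn C s)
    {u : E × E × E} (hu : u.1 ∈ s) (v w : E × E × E) :
    christoffel (deformedComp G C) u v (jetShift w) =
      jetShift (christoffel (deformedComp G C) u v w) := by
  have hu0 : jetCurve u 0 ∈ s := by rwa [jetCurve_zero]
  rw [christoffel_deformedComp_eq_curveJet hG hC hu (contDiffAt_jetCurve v)
    (contDiffAt_smul_jetCurve w) (curveJet_jetCurve v) (curveJet_smul_jetCurve w),
    christoffel_deformedComp_eq_curveJet hG hC hu (contDiffAt_jetCurve v)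
    (contDiffAt_jetCurve w) (curveJet_jetCurve v) (curveJet_jetCurve w), map_add,
    ← curveJet_smul (hG.contDiffAt_christoffel_comp hu0 (contDiffAt_jetCurve u)
      (contDiffAt_jetCurve v) (contDiffAt_jetCurve w))]
  congr 1
  · refine curveJet_congr ?_
    filter_upwards [eventually_jetCurve_mem hG.isOpen hu] with t ht
    exact hG.christoffel_smul_right ht _ _ _
  · simp [deformationTensor_zero_right hG hC hu]

theorem fderiv_christoffel_deformedComp_shift (hG : IsMetricOn G s) (hC : IsSymmetricOn C s)
    {u : E × E × E} (hu : u.1 ∈ s) (v w a : E × E × E) :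
    fderiv ℝ (fun u ↦ christoffel (deformedComp G C) u v w) u (jetShift a) =
      jetShift (fderiv ℝ (fun u ↦ christoffel (deformedComp G C) u v w) u a) := by
  rw [fderiv_christoffel_deformedComp hG hC hu v w (contDiffAt_smul_jetCurve a)
      (curveJet_smul_jetCurve a),
    fderiv_christoffel_deformedComp hG hC hu v w (contDiffAt_jetCurve a) (curveJet_jetCurve a),
    map_add, ← curveJet_smul (contDiffAt_curve_fderiv_christoffel hG hu v w
      (contDiffAt_jetCurve a))]
  simp

/-- Each of the five terms of the Lie derivative is linear in `W`. The constant operator `jetShift`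
comes out of the derivatives of `W`, of both slots of the Christoffel symbols, and of the direction
in which these are differentiated. -/
theorem lieDerivConnection_shift (hG : IsMetricOn G s) (hC : IsSymmetricOn C s)
    {W : E × E × E → E × E × E} {u : E × E × E} (hu : u.1 ∈ s) (hW : ContDiffAt ℝ ∞ W u)
    (v w : E × E × E) :
    lieDerivConnection (deformedComp G C) (fun u ↦ jetShift (W u)) u v w =
      jetShift (lieDerivConnection (deformedComp G C) W u v w) := by
  have h1 : fderiv ℝ (fun u ↦ jetShift (W u)) =ᶠ[𝓝 u] fun u ↦ jetShift.comp (fderiv ℝ W u) := by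
    filter_upwards [(contDiffAt_two_of_infty hW).eventually (by decide)] with u' hu'
    exact (jetShift.hasFDerivAt.comp u' (hu'.differentiableAt (by simp)).hasFDerivAt).fderiv
  have h2 : fderiv ℝ (fderiv ℝ (fun u ↦ jetShift (W u))) u v w =
      jetShift (fderiv ℝ (fderiv ℝ W) u v w) := by
    have hd := ((hW.fderiv_right (m := ∞) (by simp)).differentiableAt (by simp)).hasFDerivAt
    rw [h1.fderiv_eq, ((hasFDerivAt_const (jetShift : (E × E × E) →L[ℝ] _) u).clm_comp hd).fderiv]
    simp
  unfold lieDerivConnection lieDerivTensor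
  rw [h2, h1.self_of_nhds]
  simp only [ContinuousLinearMap.comp_apply]
  rw [fderiv_christoffel_deformedComp_shift hG hC hu, christoffel_deformedComp_shift_left hG hC hu,
    christoffel_deformedComp_shift_right hG hC hu, map_add, map_add, map_add, map_sub]

theorem lieDerivConnection_lift1Comp (hG : IsMetricOn G s) (hC : IsSymmetricOn C s)
    (hV : ContDiffOn ℝ ∞ V s) {u : E × E × E} (hu : u.1 ∈ s) (v w : E × E × E) :
    lieDerivConnection (deformedComp G C) (lift1Comp V) u v w = jetShift
      (curveJet fun t ↦ lieDerivConnection G V (jetCurve u t) (jetCurve v t) (jetCurve w t)) := by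
  -- `lift1Comp V` is by definition `jetShift` applied to `prolong V`; the shift then annihilates
  -- the vertical term with `L_X H`.
  refine (lieDerivConnection_shift hG hC hu (contDiffAt_prolong
    (hV.contDiffAt (hG.isOpen.mem_nhds hu))) v w).trans ?_
  rw [lieDerivConnection_prolong hG hC hV hu, map_add]
  simp

theorem lieDerivConnection_lift0Comp (hG : IsMetricOn G s) (hC : IsSymmetricOn C s)
    (hV : ContDiffOn ℝ ∞ V s) {u : E × E × E} (hu : u.1 ∈ s) (v w : E × E × E) :
    lieDerivConnection (deformedComp G C) (lift0Comp V) u v w = jetShift (jetShift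
      (curveJet fun t ↦ lieDerivConnection G V (jetCurve u t) (jetCurve v t) (jetCurve w t))) := by
  have h : ContDiffAt ℝ ∞ (lift1Comp V) u := ContDiffAt.comp (g := jetShift) u
    (ContinuousLinearMap.contDiff _).contDiffAt (contDiffAt_prolong (hV.contDiffAt (hG.isOpen.mem_nhds hu)))
  refine (lieDerivConnection_shift hG hC hu h v w).trans ?_
  rw [lieDerivConnection_lift1Comp hG hC hV hu]

theorem lieDerivConnection_lift2Comp_eq_zero_iff (hG : IsMetricOn G s) (hC : IsSymmetricOn C s)
    (hV : ContDiffOn ℝ ∞ V s) :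
    (∀ u : E × E × E, u.1 ∈ s → ∀ v w,
      lieDerivConnection (deformedComp G C) (lift2Comp V) u v w = 0) ↔
    (∀ x ∈ s, ∀ v w, lieDerivConnection G V x v w = 0) ∧
      ∀ x ∈ s, ∀ v w, lieDerivTensor V (deformationTensor G C) x v w = 0 := by
  have hl : ∀ u : E × E × E, u.1 ∈ s → ∀ v w, _ := fun u hu v w ↦
    lieDerivConnection_prolong (u := u) hG hC hV hu v w
  change (∀ u : E × E × E, u.1 ∈ s → ∀ v w,
      lieDerivConnection (deformedComp G C) (prolong V) u v w = 0) ↔ _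
  constructor
  · intro h
    have h1 : ∀ x ∈ s, ∀ v w, lieDerivConnection G V x v w = 0 := by
      intro x hx v w
      -- Constant jets suffice: the base component does not see the vertical term with `H`.
      have := h (x, 0, 0) hx (v, 0, 0) (w, 0, 0)
      rw [hl _ hx] at this
      simpa [curveJet, jetCurve_zero] using congrArg Prod.fst this
    refine ⟨h1, fun x hx v w ↦ ?_⟩
    have := h (x, 0, 0) hx (v, 0, 0) (w, 0, 0)
    rw [hl _ hx, curveJet_lieDerivConnection_eq_zero hG.isOpen hx h1] at this
    simpa using congrArg (fun q : E × E × E ↦ q.2.2) this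
  · rintro ⟨h1, h2⟩ u hu v w
    rw [hl u hu, curveJet_lieDerivConnection_eq_zero hG.isOpen hu h1, h2 _ hu]
    simp

theorem lieDerivConnection_lift1Comp_eq_zero_iff (hG : IsMetricOn G s) (hC : IsSymmetricOn C s)
    (hV : ContDiffOn ℝ ∞ V s) :
    (∀ u : E × E × E, u.1 ∈ s → ∀ v w,
      lieDerivConnection (deformedComp G C) (lift1Comp V) u v w = 0) ↔
    ∀ x ∈ s, ∀ v w, lieDerivConnection G V x v w = 0 := by
  constructor
  · intro h x hx v w
    have := h (x, 0, 0) hx (v, 0, 0) (w, 0, 0)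
    rw [lieDerivConnection_lift1Comp hG hC hV hx] at this
    -- One shift has moved the base value of `L_X ∇` into the middle component.
    simpa [curveJet, jetCurve_zero] using congrArg (fun q : E × E × E ↦ q.2.1) this
  · intro h u hu v w
    rw [lieDerivConnection_lift1Comp hG hC hV hu,
      curveJet_lieDerivConnection_eq_zero hG.isOpen hu h, map_zero]

theorem lieDerivConnection_lift0Comp_eq_zero_iff (hG : IsMetricOn G s) (hC : IsSymmetricOn C s)
    (hV : ContDiffOn ℝ ∞ V s) :
    (∀ u : E × E × E, u.1 ∈ s → ∀ v w,
      lieDerivConnection (deformedComp G C) (lift0Comp V) u v w = 0) ↔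
    ∀ x ∈ s, ∀ v w, lieDerivConnection G V x v w = 0 := by
  constructor
  · intro h x hx v w
    have := h (x, 0, 0) hx (v, 0, 0) (w, 0, 0)
    rw [lieDerivConnection_lift0Comp hG hC hV hx] at this
    simpa [curveJet, jetCurve_zero] using congrArg (fun q : E × E × E ↦ q.2.2) this
  · intro h u hu v w
    rw [lieDerivConnection_lift0Comp hG hC hV hu,
      curveJet_lieDerivConnection_eq_zero hG.isOpen hu h, map_zero, map_zero]

end LieDerivative


/-! ### Smoothness and nondegeneracy of components in a chart of the manifold. -/

section Charts

variable {E : Type*} [NormedAddCommGroup E] [NormedSpace ℝ E]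
  {M : Type*} [TopologicalSpace M] [ChartedSpace E M] [IsManifold 𝓘(ℝ, E) ∞ M]

theorem mDifferentiable_chart_of_mem_atlas {e : OpenPartialHomeomorph M E} (he : e ∈ atlas E M) :
    e.MDifferentiable 𝓘(ℝ, E) 𝓘(ℝ, E) :=
  have : IsManifold 𝓘(ℝ, E) 1 M := IsManifold.of_le (n := ∞) (by simp)
  mdifferentiable_of_mem_atlas he

theorem contMDiffOn_tangentMapWithin_chart {e : OpenPartialHomeomorph M E} (he : e ∈ atlas E M) :
    ContMDiffOn 𝓘(ℝ, E).tangent 𝓘(ℝ, E).tangent ∞ (tangentMapWithin 𝓘(ℝ, E) 𝓘(ℝ, E) e e.source)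
      (Bundle.TotalSpace.proj ⁻¹' e.source) :=
  have : IsManifold 𝓘(ℝ, E) 1 M := IsManifold.of_le (n := ∞) (by simp)
  (contMDiffOn_of_mem_maximalAtlas (mem_max he)).contMDiffOn_tangentMapWithin (by simp)
    e.open_source.uniqueMDiffOn

theorem contMDiffOn_tangentMapWithin_chart_symm {e : OpenPartialHomeomorph M E}
    (he : e ∈ atlas E M) :
    ContMDiffOn 𝓘(ℝ, E).tangent 𝓘(ℝ, E).tangent ∞
      (tangentMapWithin 𝓘(ℝ, E) 𝓘(ℝ, E) e.symm e.target)
      (Bundle.TotalSpace.proj ⁻¹' e.target) :=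
  have : IsManifold 𝓘(ℝ, E) 1 M := IsManifold.of_le (n := ∞) (by simp)
  (contMDiffOn_symm_of_mem_maximalAtlas (mem_max he)).contMDiffOn_tangentMapWithin (by simp)
    e.open_target.uniqueMDiffOn

theorem contDiffOn_vecInChart {e : OpenPartialHomeomorph M E} (he : e ∈ atlas E M)
    {X : Π q : M, TangentSpace 𝓘(ℝ, E) q}
    (hX : ContMDiff 𝓘(ℝ, E) 𝓘(ℝ, E).tangent ∞ (fun q ↦ (⟨q, X q⟩ : TangentBundle 𝓘(ℝ, E) M))) :
    ContDiffOn ℝ ∞ (vecInChart e X) e.target := by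
  have h1 : ContMDiffOn 𝓘(ℝ, E) 𝓘(ℝ, E).tangent ∞
      (fun u ↦ (⟨e.symm u, X (e.symm u)⟩ : TangentBundle 𝓘(ℝ, E) M)) e.target :=
    hX.comp_contMDiffOn (contMDiffOn_symm_of_mem_maximalAtlas (mem_max he))
  have h2 := (contMDiffOn_tangentMapWithin_chart he).comp h1 fun u hu ↦ e.map_target hu
  have h3 := (contMDiff_snd_tangentBundle_modelSpace E 𝓘(ℝ, E)).comp_contMDiffOn h2
  refine (contMDiffOn_iff_contDiffOn.1 h3).congr fun u hu ↦ ?_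
  have h4 : mfderivWithin 𝓘(ℝ, E) 𝓘(ℝ, E) e e.source (e.symm u) =
      mfderiv 𝓘(ℝ, E) 𝓘(ℝ, E) e (e.symm u) :=
    mfderivWithin_of_isOpen e.open_source (e.map_target hu)
  exact congrArg (fun L : E →L[ℝ] E ↦ L (X (e.symm u))) h4.symm

/-- These are the coordinate fields of the chart; a tensor evaluated on pairs of them gives its
components. -/
theorem contMDiffOn_chartField {e : OpenPartialHomeomorph M E} (he : e ∈ atlas E M) (v : E) :
    ContMDiffOn 𝓘(ℝ, E) 𝓘(ℝ, E).tangent ∞ (fun u ↦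
      (⟨e.symm u, mfderiv 𝓘(ℝ, E) 𝓘(ℝ, E) e.symm u v⟩ : TangentBundle 𝓘(ℝ, E) M)) e.target := by
  have h1 : ContMDiff 𝓘(ℝ, E) 𝓘(ℝ, E).tangent ∞
      (fun u ↦ (⟨u, v⟩ : TangentBundle 𝓘(ℝ, E) E)) :=
    contMDiffOn_univ.1 ((contMDiffOn_vectorSpace_iff_contDiffOn (V := fun _ ↦ v)).2
      contDiffOn_const)
  have h2 := (contMDiffOn_tangentMapWithin_chart_symm he).comp h1.contMDiffOn fun u hu ↦ hu
  refine h2.congr fun u hu ↦ ?_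
  have h4 : mfderivWithin 𝓘(ℝ, E) 𝓘(ℝ, E) e.symm e.target u =
      mfderiv 𝓘(ℝ, E) 𝓘(ℝ, E) e.symm u :=
    mfderivWithin_of_isOpen e.open_target hu
  simp only [Function.comp_apply, tangentMapWithin, h4]

theorem contDiffOn_formInChart [FiniteDimensional ℝ E] {e : OpenPartialHomeomorph M E}
    (he : e ∈ atlas E M) (c : SymmetricTensor E M) :
    ContDiffOn ℝ ∞ (formInChart e c.val) e.target := by
  refine contDiffOn_clm_apply.2 fun v ↦ contDiffOn_clm_apply.2 fun w ↦ ?_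
  have h1 := c.contMDiff.comp_contMDiffOn (contMDiffOn_symm_of_mem_maximalAtlas (mem_max he))
  have h2 := ContMDiffOn.clm_bundle_apply₂ (E₃ := Bundle.Trivial M ℝ) (F₃ := ℝ) h1
    (contMDiffOn_chartField he v) (contMDiffOn_chartField he w)
  intro u hu
  have h3 := (Bundle.contMDiffWithinAt_totalSpace.1 (h2 u hu)).2
  exact contMDiffWithinAt_iff_contDiffWithinAt.1 h3

theorem isSymmetricOn_formInChart [FiniteDimensional ℝ E] {e : OpenPartialHomeomorph M E}
    (he : e ∈ atlas E M) (c : SymmetricTensor E M) :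
    IsSymmetricOn (formInChart e c.val) e.target where
  isOpen := e.open_target
  contDiffOn := contDiffOn_formInChart he c
  symm x _ _ _ := c.symm (e.symm x) _ _

theorem isMetricOn_formInChart [FiniteDimensional ℝ E] {e : OpenPartialHomeomorph M E}
    (he : e ∈ atlas E M) (g : PseudoRiemannianMetric E M) :
    IsMetricOn (formInChart e g.val) e.target where
  toIsSymmetricOn := isSymmetricOn_formInChart he g.toSymmetricTensor
  nondegenerate x hx v h := by
    have hm := mDifferentiable_chart_of_mem_atlas he
    refine hm.symm.mfderiv_injective hx ?_
    refine (g.nondegenerate _ _ fun w ↦ ?_).trans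
      (mfderiv 𝓘(ℝ, E) 𝓘(ℝ, E) e.symm x).map_zero.symm
    obtain ⟨w', rfl⟩ := hm.symm.mfderiv_surjective hx w
    exact h w'

end Charts


/-! ### Transformation of components under a change of charts. -/

section Transition

variable {E : Type*} [NormedAddCommGroup E] [NormedSpace ℝ E]
  {M : Type*} [TopologicalSpace M] [ChartedSpace E M]

theorem vecInChart_apply {e : OpenPartialHomeomorph M E} (X : Π q : M, TangentSpace 𝓘(ℝ, E) q)
    {p : M} (hp : p ∈ e.source) :
    vecInChart e X (e p) = mfderiv 𝓘(ℝ, E) 𝓘(ℝ, E) e p (X p) := by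
  -- The point `e.symm (e p)` is generalised to `q`, since the tangent spaces at the two points are
  -- different types.
  have : ∀ q, q = p → (mfderiv 𝓘(ℝ, E) 𝓘(ℝ, E) e q (X q) : E) =
      mfderiv 𝓘(ℝ, E) 𝓘(ℝ, E) e p (X p) := by
    rintro _ rfl; rfl
  exact this _ (e.left_inv hp)

theorem formInChart_apply {e : OpenPartialHomeomorph M E}
    (g : Π p : M, TangentSpace 𝓘(ℝ, E) p →L[ℝ] TangentSpace 𝓘(ℝ, E) p →L[ℝ] ℝ)
    {p : M} (hp : p ∈ e.source) (a b : E) :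
    formInChart e g (e p) a b = g p (mfderiv 𝓘(ℝ, E) 𝓘(ℝ, E) e.symm (e p) a)
      (mfderiv 𝓘(ℝ, E) 𝓘(ℝ, E) e.symm (e p) b) := by
  have : ∀ q, q = p → ∀ a b : E,
      (g q : E →L[ℝ] E →L[ℝ] ℝ) a b = (g p : E →L[ℝ] E →L[ℝ] ℝ) a b := by
    rintro _ rfl _ _; rfl
  exact this _ (e.left_inv hp) _ _

variable [IsManifold 𝓘(ℝ, E) ∞ M]

theorem mfderiv_symm_mfderiv {e : OpenPartialHomeomorph M E} (he : e ∈ atlas E M) {p : M}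
    (hp : p ∈ e.source) (a : TangentSpace 𝓘(ℝ, E) p) :
    mfderiv 𝓘(ℝ, E) 𝓘(ℝ, E) e.symm (e p) (mfderiv 𝓘(ℝ, E) 𝓘(ℝ, E) e p a) = a :=
  congrArg (fun L : TangentSpace 𝓘(ℝ, E) p →L[ℝ] TangentSpace 𝓘(ℝ, E) p ↦ L a)
    ((mDifferentiable_chart_of_mem_atlas he).symm_comp_deriv hp)

theorem fderiv_transition {e e' : OpenPartialHomeomorph M E} (he : e ∈ atlas E M)
    (he' : e' ∈ atlas E M) {p : M} (hp : p ∈ e.source) (hp' : p ∈ e'.source) (a : E) :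
    fderiv ℝ (e.symm.trans e') (e p) a = mfderiv 𝓘(ℝ, E) 𝓘(ℝ, E) e' p
      (mfderiv 𝓘(ℝ, E) 𝓘(ℝ, E) e.symm (e p) a) := by
  have h1 := (mDifferentiable_chart_of_mem_atlas he).mdifferentiableAt_symm (e.map_source hp)
  have h2 : MDifferentiableAt 𝓘(ℝ, E) 𝓘(ℝ, E) e' (e.symm (e p)) :=
    (mDifferentiable_chart_of_mem_atlas he').mdifferentiableAt (by rwa [e.left_inv hp])
  have h3 := mfderiv_comp (e p) h2 h1
  rw [e.left_inv hp] at h3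
  rw [← mfderiv_eq_fderiv]
  exact congrArg (fun L : E →L[ℝ] E ↦ L a) h3

theorem vecInChart_transition {e e' : OpenPartialHomeomorph M E} (he : e ∈ atlas E M)
    (he' : e' ∈ atlas E M) (X : Π q : M, TangentSpace 𝓘(ℝ, E) q) {x : E}
    (hx : x ∈ (e.symm.trans e').source) :
    vecInChart e' X (e.symm.trans e' x) = fderiv ℝ (e.symm.trans e') x (vecInChart e X x) := by
  obtain ⟨p, hp, rfl⟩ : ∃ p ∈ e.source, e p = x := ⟨e.symm x, e.map_target hx.1, e.right_inv hx.1⟩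
  have hp' : p ∈ e'.source := by simpa [hp] using hx
  have h : e.symm.trans e' (e p) = e' p := by simp [hp]
  rw [h, vecInChart_apply X hp', vecInChart_apply X hp]
  exact (congrArg (fun z : TangentSpace 𝓘(ℝ, E) p ↦ (mfderiv 𝓘(ℝ, E) 𝓘(ℝ, E) e' p z : E))
    (mfderiv_symm_mfderiv he hp (X p)).symm).trans
    (fderiv_transition he he' hp hp' (mfderiv 𝓘(ℝ, E) 𝓘(ℝ, E) e p (X p))).symm

theorem formInChart_transition {e e' : OpenPartialHomeomorph M E} (he : e ∈ atlas E M)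
    (he' : e' ∈ atlas E M)
    (g : Π p : M, TangentSpace 𝓘(ℝ, E) p →L[ℝ] TangentSpace 𝓘(ℝ, E) p →L[ℝ] ℝ) {x : E}
    (hx : x ∈ (e.symm.trans e').source) (a b : E) :
    formInChart e' g (e.symm.trans e' x) (fderiv ℝ (e.symm.trans e') x a)
      (fderiv ℝ (e.symm.trans e') x b) = formInChart e g x a b := by
  obtain ⟨p, hp, rfl⟩ : ∃ p ∈ e.source, e p = x := ⟨e.symm x, e.map_target hx.1, e.right_inv hx.1⟩
  have hp' : p ∈ e'.source := by simpa [hp] using hx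
  have h : e.symm.trans e' (e p) = e' p := by simp [hp]
  rw [h, formInChart_apply g hp', formInChart_apply g hp, fderiv_transition he he' hp hp',
    fderiv_transition he he' hp hp']
  have k : ∀ a : E, _ := fun a ↦
    mfderiv_symm_mfderiv he' hp' (mfderiv 𝓘(ℝ, E) 𝓘(ℝ, E) e.symm (e p) a)
  exact congrArg₂ (fun a b : E ↦ (g p : E →L[ℝ] E →L[ℝ] ℝ) a b) (k a) (k b)

end Transition

/-! ### Invariance of the lift formulas under prolonged coordinate changes. -/

section Naturality

variable {E : Type*} [NormedAddCommGroup E] [NormedSpace ℝ E]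

/-- Prolongation of the relation `V' ∘ φ = Dφ(V)`, by functoriality and `fderiv_prolong`. The lower
lifts follow because `jetShift` commutes with the differential of `prolong φ`. -/
theorem lift2Comp_transition {φ V V' : E → E} {u : E × E × E} (hφ : ContDiffAt ℝ ∞ φ u.1)
    (hV : ContDiffAt ℝ ∞ V u.1) (hV' : ContDiffAt ℝ ∞ V' (φ u.1))
    (h : ∀ᶠ x in 𝓝 u.1, V' (φ x) = fderiv ℝ φ x (V x)) :
    fderiv ℝ (prolong φ) u (lift2Comp V u) = lift2Comp V' (prolong φ u) := by
  change fderiv ℝ (prolong φ) u (prolong V u) = prolong V' (prolong φ u)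
  rw [← prolong_comp hφ hV', prolong_congr h, fderiv_prolong hφ,
    prolong_comp (f := fun p : E × E ↦ fderiv ℝ φ p.1 p.2) (g := fun x ↦ (x, V x))
      (contDiffAt_id.prodMk hV) (contDiffAt_fderiv_apply hφ)]
  have := prolong_prodMk (f := fun x : E ↦ x) contDiffAt_id hV
  rw [this, prolong_id]

theorem lift1Comp_transition {φ V V' : E → E} {u : E × E × E} (hφ : ContDiffAt ℝ ∞ φ u.1)
    (hV : ContDiffAt ℝ ∞ V u.1) (hV' : ContDiffAt ℝ ∞ V' (φ u.1))
    (h : ∀ᶠ x in 𝓝 u.1, V' (φ x) = fderiv ℝ φ x (V x)) :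
    fderiv ℝ (prolong φ) u (lift1Comp V u) = lift1Comp V' (prolong φ u) := by
  refine (fderiv_prolong_jetShift hφ (lift2Comp V u)).trans ?_
  rw [lift2Comp_transition hφ hV hV' h]
  rfl

theorem lift0Comp_transition {φ V V' : E → E} {u : E × E × E} (hφ : ContDiffAt ℝ ∞ φ u.1)
    (hV : ContDiffAt ℝ ∞ V u.1) (hV' : ContDiffAt ℝ ∞ V' (φ u.1))
    (h : ∀ᶠ x in 𝓝 u.1, V' (φ x) = fderiv ℝ φ x (V x)) :
    fderiv ℝ (prolong φ) u (lift0Comp V u) = lift0Comp V' (prolong φ u) := by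
  refine (fderiv_prolong_jetShift hφ (lift1Comp V u)).trans ?_
  rw [lift1Comp_transition hφ hV hV' h]
  rfl

/-- The transformed jets are represented by the transformed curves, along which the transformation
law of `G` holds pointwise; both sides are `t²`-coefficients of the same function near `0`. -/
theorem lift2FormComp_transition {φ : E → E} {G G' : E → E →L[ℝ] E →L[ℝ] ℝ} {s s' : Set E}
    (hG : IsSymmetricOn G s) (hG' : IsSymmetricOn G' s') {u : E × E × E}
    (hu : u.1 ∈ s) (hu' : φ u.1 ∈ s') (hφ : ContDiffAt ℝ ∞ φ u.1)
    (h : ∀ᶠ x in 𝓝 u.1, ∀ a b, G' (φ x) (fderiv ℝ φ x a) (fderiv ℝ φ x b) = G x a b)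
    (a b : E × E × E) :
    lift2FormComp G' (prolong φ u) (fderiv ℝ (prolong φ) u a) (fderiv ℝ (prolong φ) u b) =
      lift2FormComp G u a b := by
  have hφ0 : ContDiffAt ℝ ∞ φ (jetCurve u 0) := by rwa [jetCurve_zero]
  have hc : ContDiffAt ℝ ∞ (fun t ↦ φ (jetCurve u t)) 0 :=
    ContDiffAt.comp (g := φ) 0 hφ0 (contDiffAt_jetCurve u)
  have hd : ∀ a : E × E × E,
      ContDiffAt ℝ ∞ (fun t ↦ fderiv ℝ φ (jetCurve u t) (jetCurve a t)) 0 := fun a ↦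
    ContDiffAt.comp (g := fun p : E × E ↦ fderiv ℝ φ p.1 p.2)
      (f := fun t ↦ (jetCurve u t, jetCurve a t)) 0 (contDiffAt_fderiv_apply hφ0)
      ((contDiffAt_jetCurve u).prodMk (contDiffAt_jetCurve a))
  have hj : ∀ a : E × E × E, curveJet (fun t ↦ fderiv ℝ φ (jetCurve u t) (jetCurve a t)) =
      fderiv ℝ (prolong φ) u a := fun a ↦ by
    rw [fderiv_prolong hφ, prolong_eq_curveJet (u := jetPair u a) (contDiffAt_fderiv_apply hφ)]
    rfl
  have hs : ContDiffAt ℝ ∞ (fun p : E × E × E ↦ G' p.1 p.2.1 p.2.2)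
      ((prolong φ u).1, (fderiv ℝ (prolong φ) u a).1, (fderiv ℝ (prolong φ) u b).1) :=
    hG'.contDiffAt_apply hu'
  rw [lift2FormComp_eq_prolong hG' hu', lift2FormComp_eq_curveJet hG hu (contDiffAt_jetCurve a)
    (curveJet_jetCurve a), prolong_jetPair₃ hs hc (hd a) (hd b)
    (prolong_eq_curveJet hφ).symm (hj a) (hj b)]
  refine congrArg (fun q : ℝ × ℝ × ℝ ↦ q.2.2) (curveJet_congr ?_)
  have h0 : Filter.Tendsto (jetCurve u) (𝓝 0) (𝓝 u.1) := by
    simpa [jetCurve_zero] using (contDiff_jetCurve u).continuous.tendsto 0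
  filter_upwards [h0.eventually h] with t ht using ht _ _

end Naturality

/-! ### Components of the lifts in every induced chart. -/

section InducedCharts

variable {E : Type*} [NormedAddCommGroup E] [NormedSpace ℝ E]
  {M : Type*} [TopologicalSpace M] [ChartedSpace E M] [IsManifold 𝓘(ℝ, E) ∞ M]

theorem inducedChart_mem_atlas {e : OpenPartialHomeomorph M E} (he : e ∈ atlas E M) :
    inducedChart e he ∈ atlas (E × E × E) (SecondTangentBundle E M) :=
  mem_atlas_iff.2 ⟨e, he, rfl⟩

/-- Equality of germs, so that the derivatives of the transition map are also those of the
prolongation. -/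
theorem inducedChart_transition_eventuallyEq {e e' : OpenPartialHomeomorph M E}
    (he : e ∈ atlas E M) (he' : e' ∈ atlas E M) {u : E × E × E}
    (hu : u.1 ∈ (e.symm.trans e').source) :
    (inducedChart e he).symm.trans (inducedChart e' he') =ᶠ[𝓝 u] prolong (e.symm.trans e') := by
  filter_upwards [((e.symm.trans e').open_source.preimage continuous_fst).mem_nhds hu] with u' hu'
  exact inducedCoord_symm he he' hu'

theorem contDiffAt_transition {e e' : OpenPartialHomeomorph M E}
    (he : e ∈ atlas E M) (he' : e' ∈ atlas E M) {x : E} (hx : x ∈ (e.symm.trans e').source) :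
    ContDiffAt ℝ ∞ (e.symm.trans e') x :=
  (contDiffOn_transition he he').contDiffAt ((e.symm.trans e').open_source.mem_nhds hx)

theorem mem_chartAround_source (p : SecondTangentBundle E M) : p ∈ (chartAround p).source :=
  mem_chart_source E (proj p)

theorem chartAround_mem_atlas (p : SecondTangentBundle E M) :
    chartAround p ∈ atlas (E × E × E) (SecondTangentBundle E M) :=
  inducedChart_mem_atlas _

theorem inducedChart_fst_mem {e e' : OpenPartialHomeomorph M E} (he : e ∈ atlas E M)
    (he' : e' ∈ atlas E M) {p : SecondTangentBundle E M} (hp : p ∈ (inducedChart e he).source)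
    (hp' : p ∈ (inducedChart e' he').source) :
    (inducedChart e he p).1 ∈ (e.symm.trans e').source := by
  have hm : inducedChart e he p ∈
      ((inducedChart e he).symm.trans (inducedChart e' he')).source := by
    simp [hp, hp']
  exact (Set.ext_iff.1 (inducedPartialEquiv_trans_source he he') _).1 hm

theorem inducedChart_eq_prolong {e e' : OpenPartialHomeomorph M E} (he : e ∈ atlas E M)
    (he' : e' ∈ atlas E M) {p : SecondTangentBundle E M} (hp : p ∈ (inducedChart e he).source)
    (hp' : p ∈ (inducedChart e' he').source) :
    inducedChart e' he' p = prolong (e.symm.trans e') (inducedChart e he p) := by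
  have h := (inducedChart_transition_eventuallyEq he he'
    (inducedChart_fst_mem he he' hp hp')).self_of_nhds
  rw [← h]
  simp [hp]

theorem fderiv_prolong_transition {e e' : OpenPartialHomeomorph M E} (he : e ∈ atlas E M)
    (he' : e' ∈ atlas E M) {p : SecondTangentBundle E M} (hp : p ∈ (inducedChart e he).source)
    (hp' : p ∈ (inducedChart e' he').source) (a : E × E × E) :
    fderiv ℝ (prolong (e.symm.trans e')) (inducedChart e he p) a =
      mfderiv 𝓘(ℝ, E × E × E) 𝓘(ℝ, E × E × E) (inducedChart e' he') p
        (mfderiv 𝓘(ℝ, E × E × E) 𝓘(ℝ, E × E × E) (inducedChart e he).symm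
          (inducedChart e he p) a) := by
  rw [← (inducedChart_transition_eventuallyEq he he'
    (inducedChart_fst_mem he he' hp hp')).fderiv_eq]
  exact fderiv_transition (inducedChart_mem_atlas he) (inducedChart_mem_atlas he') hp hp' a

theorem vecOfComp_eq_mfderiv_symm (p : SecondTangentBundle E M) (a : E × E × E) :
    vecOfComp p a = mfderiv 𝓘(ℝ, E × E × E) 𝓘(ℝ, E × E × E) (chartAround p).symm
      (chartAround p p) a :=
  congrArg (fun L : (E × E × E) →L[ℝ] (E × E × E) ↦ L a) (ContinuousLinearMap.inverse_equiv
    ((mDifferentiable_chart_of_mem_atlas (chartAround_mem_atlas p)).mfderiv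
      (mem_chartAround_source p)))

/-- A vector field on `T²M` whose components in the preferred charts are `L V`, where `V` are the
components of `X` and `L` is natural under changes of coordinates, has the components `L V` in
every induced chart. -/
theorem vecInChart_inducedChart {e : OpenPartialHomeomorph M E} (he : e ∈ atlas E M)
    {X : Π q : M, TangentSpace 𝓘(ℝ, E) q}
    (hX : ContMDiff 𝓘(ℝ, E) 𝓘(ℝ, E).tangent ∞ (fun q ↦ (⟨q, X q⟩ : TangentBundle 𝓘(ℝ, E) M)))
    (L : (E → E) → E × E × E → E × E × E)
    (hL : ∀ {φ V V' : E → E} {u : E × E × E}, ContDiffAt ℝ ∞ φ u.1 → ContDiffAt ℝ ∞ V u.1 →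
      ContDiffAt ℝ ∞ V' (φ u.1) → (∀ᶠ x in 𝓝 u.1, V' (φ x) = fderiv ℝ φ x (V x)) →
      fderiv ℝ (prolong φ) u (L V u) = L V' (prolong φ u))
    {u : E × E × E} (hu : u.1 ∈ e.target) :
    vecInChart (inducedChart e he) (fun p ↦ vecOfComp p
      (L (vecInChart (chartAt E (proj p)) X) (chartAround p p))) u = L (vecInChart e X) u := by
  obtain ⟨p, hp, rfl⟩ : ∃ p ∈ (inducedChart e he).source, inducedChart e he p = u :=
    ⟨(inducedChart e he).symm u, (inducedChart e he).map_target hu,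
      (inducedChart e he).right_inv hu⟩
  have hc := chart_mem_atlas E (proj p)
  have hpc := mem_chartAround_source p
  have hm := inducedChart_fst_mem hc he hpc hp
  rw [vecInChart_apply _ hp, vecOfComp_eq_mfderiv_symm]
  -- The components in `inducedChart e he` are the image of those in the preferred chart at `p`
  -- under the differential of the prolonged transition map, to which the naturality `hL` applies.
  refine (fderiv_prolong_transition hc he hpc hp _).symm.trans ?_
  rw [inducedChart_eq_prolong hc he hpc hp]
  refine hL (contDiffAt_transition hc he hm) ?_ ?_ ?_
  · exact (contDiffOn_vecInChart hc hX).contDiffAt ((chartAt E (proj p)).open_target.mem_nhds hm.1)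
  · refine (contDiffOn_vecInChart he hX).contDiffAt (e.open_target.mem_nhds ?_)
    exact (((chartAt E (proj p)).symm.trans e).map_source hm).1
  · filter_upwards [((chartAt E (proj p)).symm.trans e).open_source.mem_nhds hm] with x hx
    exact vecInChart_transition hc he X hx

theorem formInChart_inducedChart_formOfComp {e : OpenPartialHomeomorph M E} (he : e ∈ atlas E M)
    (B : SecondTangentBundle E M → (E × E × E) →L[ℝ] (E × E × E) →L[ℝ] ℝ)
    {p : SecondTangentBundle E M} (hp : p ∈ (inducedChart e he).source) (a b : E × E × E) :
    formInChart (inducedChart e he) (fun p ↦ formOfComp p (B p)) (inducedChart e he p) a b =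
      B p (fderiv ℝ (prolong (e.symm.trans (chartAt E (proj p)))) (inducedChart e he p) a)
        (fderiv ℝ (prolong (e.symm.trans (chartAt E (proj p)))) (inducedChart e he p) b) := by
  have hc := chart_mem_atlas E (proj p)
  have hpc := mem_chartAround_source p
  rw [formInChart_apply _ hp, fderiv_prolong_transition he hc hp hpc,
    fderiv_prolong_transition he hc hp hpc]
  rfl

/-- The deformed 2-nd lift metric has the same form in every induced chart. -/
theorem formInChart_deformedMetric [FiniteDimensional ℝ E] {e : OpenPartialHomeomorph M E}
    (he : e ∈ atlas E M) (g : PseudoRiemannianMetric E M) (c : SymmetricTensor E M)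
    {u : E × E × E} (hu : u.1 ∈ e.target) :
    formInChart (inducedChart e he) (deformedMetric g c) u =
      deformedComp (formInChart e g.val) (formInChart e c.val) u := by
  obtain ⟨p, hp, rfl⟩ : ∃ p ∈ (inducedChart e he).source, inducedChart e he p = u :=
    ⟨(inducedChart e he).symm u, (inducedChart e he).map_target hu,
      (inducedChart e he).right_inv hu⟩
  have hc := chart_mem_atlas E (proj p)
  have hpc := mem_chartAround_source p
  have hm := inducedChart_fst_mem he hc hp hpc
  have hφ := contDiffAt_transition he hc hm
  have ht : (e.symm.trans (chartAt E (proj p))) (inducedChart e he p).1 ∈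
      (chartAt E (proj p)).target := ((e.symm.trans (chartAt E (proj p))).map_source hm).1
  refine ContinuousLinearMap.ext fun a ↦ ContinuousLinearMap.ext fun b ↦ ?_
  have h1 : formInChart (inducedChart e he) (lift2Form g.val) (inducedChart e he p) a b =
      lift2FormComp (formInChart e g.val) (inducedChart e he p) a b := by
    refine (formInChart_inducedChart_formOfComp he (fun p ↦ lift2FormComp
      (formInChart (chartAt E (proj p)) g.val) (chartAround p p)) hp a b).trans ?_
    have h2 : chartAround p p = _ := inducedChart_eq_prolong he hc hp hpc
    rw [h2]
    refine lift2FormComp_transition (isSymmetricOn_formInChart he g.toSymmetricTensor)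
      (isSymmetricOn_formInChart hc g.toSymmetricTensor) hu ht hφ ?_ a b
    filter_upwards [(e.symm.trans (chartAt E (proj p))).open_source.mem_nhds hm] with x hx a b
    exact formInChart_transition he hc g.val hx a b
  have h3 : formInChart (inducedChart e he) (lift0Form c.val) (inducedChart e he p) a b =
      lift0FormComp (formInChart e c.val) (inducedChart e he p) a b := by
    refine (formInChart_inducedChart_formOfComp he (fun p ↦ lift0FormComp
      (formInChart (chartAt E (proj p)) c.val) (chartAround p p)) hp a b).trans ?_
    have h2 : chartAround p p = _ := inducedChart_eq_prolong he hc hp hpc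
    rw [h2, lift0FormComp_apply, fderiv_prolong_fst hφ, fderiv_prolong_fst hφ]
    exact formInChart_transition he hc c.val hm a.1 b.1
  exact congrArg₂ (· + ·) h1 h3

end InducedCharts


/-! ### Reduction of the affine Killing condition on `T²M` to the charts of `M`. -/

section Main

/-- The components are known only on the chart target, which is open; this suffices because the Lie
derivative depends only on germs. -/
theorem lieDerivConnection_congr {F : Type*} [NormedAddCommGroup F] [NormedSpace ℝ F]
    {G G' : F → F →L[ℝ] F →L[ℝ] ℝ} {V V' : F → F} {s : Set F} (hs : IsOpen s)
    (hG : ∀ u ∈ s, G u = G' u) (hV : ∀ u ∈ s, V u = V' u) {u : F} (hu : u ∈ s) (v w : F) :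
    lieDerivConnection G V u v w = lieDerivConnection G' V' u v w := by
  have hΓ : ∀ x ∈ s, ∀ v w, christoffel G x v w = christoffel G' x v w := by
    intro x hx v w
    have h : G =ᶠ[𝓝 x] G' := by filter_upwards [hs.mem_nhds hx] with y hy using hG y hy
    simp only [christoffel, h.fderiv_eq, hG x hx]
  have h1 : V =ᶠ[𝓝 u] V' := by filter_upwards [hs.mem_nhds hu] with y hy using hV y hy
  have h2 : (fun x ↦ christoffel G x v w) =ᶠ[𝓝 u] fun x ↦ christoffel G' x v w := by
    filter_upwards [hs.mem_nhds hu] with y hy using hΓ y hy v w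
  simp only [lieDerivConnection, lieDerivTensor, h1.fderiv_eq, h1.fderiv.fderiv_eq, h2.fderiv_eq,
    hV u hu, hΓ u hu]

variable {E : Type*} [NormedAddCommGroup E] [NormedSpace ℝ E] [FiniteDimensional ℝ E]
  {M : Type*} [TopologicalSpace M] [ChartedSpace E M] [IsManifold 𝓘(ℝ, E) ∞ M]

theorem isAffineKilling_deformedMetric_iff (g : PseudoRiemannianMetric E M)
    (c : SymmetricTensor E M) {Y : Π p : SecondTangentBundle E M, TangentSpace 𝓘(ℝ, E × E × E) p}
    {W : OpenPartialHomeomorph M E → E × E × E → E × E × E}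
    (hY : ∀ e, ∀ he : e ∈ atlas E M, ∀ u : E × E × E, u.1 ∈ e.target →
      vecInChart (inducedChart e he) Y u = W e u) :
    IsAffineKilling (deformedMetric g c) Y ↔ ∀ e ∈ atlas E M, ∀ u : E × E × E, u.1 ∈ e.target →
      ∀ v w, lieDerivConnection (deformedComp (formInChart e g.val) (formInChart e c.val)) (W e)
        u v w = 0 := by
  have key : ∀ e, ∀ he : e ∈ atlas E M, ∀ u : E × E × E, u.1 ∈ e.target → ∀ v w,
      lieDerivConnection (formInChart (inducedChart e he) (deformedMetric g c))
        (vecInChart (inducedChart e he) Y) u v w =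
      lieDerivConnection (deformedComp (formInChart e g.val) (formInChart e c.val)) (W e) u v w :=
    fun e he u hu v w ↦ lieDerivConnection_congr (e.open_target.preimage continuous_fst)
      (fun u hu ↦ formInChart_deformedMetric he g c hu) (fun u hu ↦ hY e he u hu) hu v w
  constructor
  · intro h e he u hu v w
    rw [← key e he u hu]
    exact h _ (inducedChart_mem_atlas he) u hu v w
  · intro h f hf u hu v w
    -- The atlas of `T²M` contains nothing but induced charts.
    obtain ⟨e, he, rfl⟩ := mem_atlas_iff.1 hf
    rw [key e he u hu]
    exact h e he u hu v w

end Main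

end SecondTangent

end

/-! ### The proposition, assembled from the chartwise equivalences. -/

theorem mainTheorem7 {E : Type*} [NormedAddCommGroup E] [NormedSpace ℝ E] [FiniteDimensional ℝ E]
    {M : Type*} [TopologicalSpace M] [ChartedSpace E M] [IsManifold 𝓘(ℝ, E) ∞ M]
    (g : SecondTangent.PseudoRiemannianMetric E M) (c : SecondTangent.SymmetricTensor E M)
    (X : Π q : M, TangentSpace 𝓘(ℝ, E) q)
    (hX : ContMDiff 𝓘(ℝ, E) 𝓘(ℝ, E).tangent ∞ (fun q ↦ (⟨q, X q⟩ : TangentBundle 𝓘(ℝ, E) M))) :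
    ((SecondTangent.IsAffineKilling (SecondTangent.deformedMetric g c) (SecondTangent.lift0 X) ↔
        SecondTangent.IsAffineKilling g.val X) ∧
      (SecondTangent.IsAffineKilling (SecondTangent.deformedMetric g c) (SecondTangent.lift1 X) ↔
        SecondTangent.IsAffineKilling g.val X)) ∧
    (SecondTangent.IsAffineKilling (SecondTangent.deformedMetric g c) (SecondTangent.lift2 X) ↔
      SecondTangent.IsAffineKilling g.val X ∧
        SecondTangent.LieDerivDeformationVanishes g.val c.val X) := by
  open SecondTangent in
  refine ⟨⟨?_, ?_⟩, ?_⟩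
  · rw [isAffineKilling_deformedMetric_iff g c (Y := lift0 X)
        (W := fun e ↦ lift0Comp (vecInChart e X))
      fun e he u hu ↦ vecInChart_inducedChart he hX lift0Comp lift0Comp_transition hu]
    exact forall₂_congr fun e he ↦ lieDerivConnection_lift0Comp_eq_zero_iff
      (isMetricOn_formInChart he g) (isSymmetricOn_formInChart he c) (contDiffOn_vecInChart he hX)
  · rw [isAffineKilling_deformedMetric_iff g c (Y := lift1 X)
        (W := fun e ↦ lift1Comp (vecInChart e X))
      fun e he u hu ↦ vecInChart_inducedChart he hX lift1Comp lift1Comp_transition hu]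
    exact forall₂_congr fun e he ↦ lieDerivConnection_lift1Comp_eq_zero_iff
      (isMetricOn_formInChart he g) (isSymmetricOn_formInChart he c) (contDiffOn_vecInChart he hX)
  · rw [isAffineKilling_deformedMetric_iff g c (Y := lift2 X)
        (W := fun e ↦ lift2Comp (vecInChart e X))
      fun e he u hu ↦ vecInChart_inducedChart he hX lift2Comp lift2Comp_transition hu]
    refine Iff.trans (forall₂_congr fun e he ↦ lieDerivConnection_lift2Comp_eq_zero_iff
      (isMetricOn_formInChart he g) (isSymmetricOn_formInChart he c)
      (contDiffOn_vecInChart he hX)) ?_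
    exact ⟨fun h ↦ ⟨fun e he ↦ (h e he).1, fun e he ↦ (h e he).2⟩,
      fun h e he ↦ ⟨h.1 e he, h.2 e he⟩⟩
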